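/- Let $n\ge 1$, $N=2n+1$, and let $\mathbb H^n=\mathbb R^n\times\mathbb R^n\times\mathbb R$ be the Heisenberg group with group law $$(x,y,t)\cdot(x',y',t')=\Big(x+x',\,y+y',\,t+t'+2\sum_{j=1}^n(x'_jy_j-x_jy'_j)\Big),$$ dilations $\delta_\varepsilon(x,y,t)=(\varepsilon x,\varepsilon y,\varepsilon^2t)$, Lebesgue measure, and left-invariant vector fields $X_j=\partial_{x_j}+2y_j\partial_t$, $Y_j=\partial_{y_j}-2x_j\partial_t$ ($1\le j\le n$), $T=\partial_t$; write $Z_j=X_j$, $Z_{n+j}=Y_j$. For $w=(x,y,t)\in\mathbb H^n$ put $w_{\mathcal H}=(x,y)\in\mathbb R^{2n}$ and $w_N=t$. Let $d$ be the Carnot–Carathéodory distance, i.e. $d(p,q)$ is the infimum of the lengths of absolutely continuous curves $\gamma:[0,1]\to\mathbb H^n$ from $p$ to $q$ with $\dot\gamma(\tau)\in\mathrm{span}\{Z_1,\dots,Z_{2n}\}(\gamma(\tau))$ for a.e. $\tau$, the length being taken in the Riemannian metric that makes $X_1,\dots,X_n,Y_1,\dots,Y_n,T$ orthonormal; $\mathrm{dist}$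 denotes the corresponding distance between sets (equal to $+\infty$ if one of them is empty). For $\Omega\subseteq\mathbb H^n$ open and $s\in[1,\infty]$, $W^{1,s}_{\mathcal H}(\Omega)$ is the space of $f\in L^s(\Omega)$ whose distributional derivatives $Z_jf$, defined by $\langle Z_jf,\varphi\rangle=-\int_\Omega f\,Z_j\varphi\,dp$ for $\varphi\in C^\infty_c(\Omega)$, belong to $L^s(\Omega)$ for $j=1,\dots,2n$; and $\nabla^{\mathcal H}f=(Z_1f,\dots,Z_{2n}f)$. **Theorem.** Let $s\in[1,\infty)$, let $\Omega\subseteq\mathbb H^n$ be open, let $f\in W^{1,s}_{\mathcal H}(\Omega)$, and let $A\subseteq\Omega$ be open with $\mathrm{dist}(A,\partial\Omega)>0$. Then, for every $w\in\mathbb H^n$, as $\varepsilon\searrow0$, $$\frac{f(p\cdot\delta_\varepsilon(w))-f(p)}{\varepsilon}\longrightarrow\langle\nabla^{\mathcal H}f(p),w_{\mathcal H}\rangle\qquad\text{in }L^s(A)\text{ (as functions of }p).$$ In addition, if $w\in\mathbb H^n$ and $\varepsilon>0$ satisfy $\varepsilon\big(|w_{\mathcal H}|+2\sqrt{|w_N|}\big)<\mathrm{dist}(A,\partial\Omega)$,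 then $p\cdot\delta_\varepsilon(w)\in\Omega$ for every $p\in A$, the difference quotient belongs to $L^s(A)$, and $$\left\|\frac{f(p\cdot\delta_\varepsilon(w))-f(p)}{\varepsilon}\right\|_{L^s(A)}\le\big(|w_{\mathcal H}|+2\sqrt{|w_N|}\big)\,\|\nabla^{\mathcal H}f\|_{L^s(\Omega)}.$$ -/

import Mathlib

open MeasureTheory Filter Topology
open scoped ENNReal

noncomputable section

namespace Heisenberg

/-- The space `ℝ^{2n}` of horizontal components: `Sum.inl j` indexes `x_j`, `Sum.inr j`
indexes `y_j`. -/
abbrev Hor (n : ℕ) : Type := EuclideanSpace ℝ (Fin n ⊕ Fin n)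

/-- The underlying space `ℝ^{2n+1}` of the `n`-th Heisenberg group; a point `p = (x, y, t)` has
horizontal part `p.1 = (x, y)` and vertical part `p.2 = t`. Its `volume` is the Lebesgue measure. -/
abbrev Heis (n : ℕ) : Type := Hor n × ℝ

variable {n : ℕ}

/-- The group law
`(x,y,t) · (x',y',t') = (x + x', y + y', t + t' + 2 ∑ j, (x'_j y_j - x_j y'_j))`. -/
def mul (p q : Heis n) : Heis n :=
  (p.1 + q.1,
    p.2 + q.2 + 2 * ∑ j : Fin n,
      (q.1 (Sum.inl j) * p.1 (Sum.inr j) - p.1 (Sum.inl j) * q.1 (Sum.inr j)))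

/-- The intrinsic dilations `δ_r (x,y,t) = (r x, r y, r² t)`. -/
def dil (r : ℝ) (p : Heis n) : Heis n := (r • p.1, r ^ 2 * p.2)

/-- The coefficient of `∂_t` in `Z_j(p)`: `2 y_j` for `X_j`, and `- 2 x_j` for `Y_j`. -/
def vertCoeff (j : Fin n ⊕ Fin n) (p : Heis n) : ℝ :=
  match j with
  | Sum.inl i => 2 * p.1 (Sum.inr i)
  | Sum.inr i => -(2 * p.1 (Sum.inl i))

/-- The horizontal left-invariant vector fields: `Z (Sum.inl j) = X_j = ∂_{x_j} + 2 y_j ∂_t` and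
`Z (Sum.inr j) = Y_j = ∂_{y_j} - 2 x_j ∂_t`. -/
def Z (j : Fin n ⊕ Fin n) (p : Heis n) : Heis n :=
  (EuclideanSpace.single j 1, vertCoeff j p)

/-- The action `Z_j φ` of `Z_j` on a differentiable function. -/
def ZDeriv (j : Fin n ⊕ Fin n) (φ : Heis n → ℝ) (p : Heis n) : ℝ := fderiv ℝ φ p (Z j p)

/-- The horizontal distribution at `p`. -/
def horizontalSpace (p : Heis n) : Submodule ℝ (Heis n) :=
  Submodule.span ℝ (Set.range fun j => Z j p)

/-- The component along `T = ∂_t` of a tangent vector `v` at `p`, in the left-invariant frame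
`X_1, …, X_n, Y_1, …, Y_n, T`; the components along `X_j`, `Y_j` are the coordinates of `v.1`. -/
def tComponent (p v : Heis n) : ℝ := v.2 - ∑ j, v.1 j * vertCoeff j p

/-- The left-invariant Riemannian metric for which `X_1, …, X_n, Y_1, …, Y_n, T` is
orthonormal. -/
def metric (p v v' : Heis n) : ℝ := inner ℝ v.1 v'.1 + tComponent p v * tComponent p v'

/-- Absolutely continuous horizontal curves `γ : [0,1] → ℍⁿ` (values outside `[0,1]` are
irrelevant). -/
def IsHorizontalCurve (γ : ℝ → Heis n) : Prop :=
  AbsolutelyContinuousOnInterval γ 0 1 ∧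
    ∀ᵐ τ ∂(volume.restrict (Set.Icc (0 : ℝ) 1)), deriv γ τ ∈ horizontalSpace (γ τ)

/-- The length of a curve `γ : [0,1] → ℍⁿ`. -/
def curveLength (γ : ℝ → Heis n) : ℝ≥0∞ :=
  ∫⁻ τ in Set.Icc (0 : ℝ) 1, ENNReal.ofReal (√(metric (γ τ) (deriv γ τ) (deriv γ τ)))

/-- The Carnot–Carathéodory distance. -/
def ccDist (p q : Heis n) : ℝ≥0∞ :=
  ⨅ (γ : ℝ → Heis n) (_ : IsHorizontalCurve γ) (_ : γ 0 = p) (_ : γ 1 = q), curveLength γ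

/-- The Carnot–Carathéodory distance between two sets, equal to `∞` if one of them is empty. -/
def ccSetDist (S S' : Set (Heis n)) : ℝ≥0∞ := ⨅ p ∈ S, ⨅ q ∈ S', ccDist p q

/-- On the open set `Ω`, the distribution `Z_j u` is represented by the locally integrable
function `g`. -/
def IsWeakZDeriv (Ω : Set (Heis n)) (j : Fin n ⊕ Fin n) (u g : Heis n → ℝ) : Prop :=
  LocallyIntegrableOn u Ω volume ∧ LocallyIntegrableOn g Ω volume ∧
    ∀ φ : Heis n → ℝ, ContDiff ℝ ((⊤ : ℕ∞) : WithTop ℕ∞) φ → HasCompactSupport φ →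
      tsupport φ ⊆ Ω → ∫ p in Ω, g p * φ p = -∫ p in Ω, u p * ZDeriv j φ p

/-- `G` represents the weak horizontal gradient `(X_1 u, …, X_n u, Y_1 u, …, Y_n u)` on `Ω`. -/
def IsWeakHorizontalGradient (Ω : Set (Heis n)) (u : Heis n → ℝ) (G : Heis n → Hor n) : Prop :=
  ∀ j, IsWeakZDeriv Ω j u fun p => G p j

/-- Membership in the horizontal Sobolev space `W^{1,s}_H(Ω)`. -/
def MemHorizontalSobolev (s : ℝ≥0∞) (Ω : Set (Heis n)) (u : Heis n → ℝ) : Prop :=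
  MemLp u s (volume.restrict Ω) ∧
    ∀ j, ∃ g : Heis n → ℝ, MemLp g s (volume.restrict Ω) ∧ IsWeakZDeriv Ω j u g

/-- The first-order intrinsic difference quotient `p ↦ (f (p · δ_ε w) - f p) / ε`. -/
def diffQuot (f : Heis n → ℝ) (w : Heis n) (ε : ℝ) (p : Heis n) : ℝ :=
  (f (mul p (dil ε w)) - f p) / ε

end Heisenberg

end

/-! Every point `w` is reached from the origin by the horizontal segment with velocity `w_H`
followed by a horizontal square, of total length `2 √|w_N|`, whose sides are `a, b, -a, -b`: the
square has no net horizontal displacement and its vertical displacement is `2 symp a b`.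

Along one segment, `f (p · exp v) - f p = ∫₀¹ ⟨∇f (p · exp (τ v)), v⟩ dτ` for almost every `p`. This
is dual to the fundamental theorem of calculus for test functions: a left-invariant field is
invariant under its own flow, which consists of right translations and so preserves Lebesgue
measure. Minkowski's inequality then bounds the increment, and `L^s`-continuity of right
translations identifies the limit of the difference quotient. Both statements add up along a path of
segments; a path shorter than the distance to the boundary stays in `Ω`. -/

noncomputable section

section Minkowski

variable {X T E : Type*} [MeasurableSpace X] [MeasurableSpace T] [NormedAddCommGroup E]
  {μ : Measure X} [SFinite μ] {ν : Measure T} {s : ℝ≥0∞} {H : X × T → E} {C : ℝ≥0∞}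

lemma lintegral_lintegral_rpow_enorm_le [IsProbabilityMeasure ν] (hs : s ≠ 0) (hs' : s ≠ ∞)
    (hH : AEStronglyMeasurable H (μ.prod ν))
    (hC : ∀ᵐ τ ∂ν, eLpNorm (fun x => H (x, τ)) s μ ≤ C) :
    ∫⁻ x, ∫⁻ τ, ‖H (x, τ)‖ₑ ^ s.toReal ∂ν ∂μ ≤ C ^ s.toReal := by
  have hr : 0 < s.toReal := ENNReal.toReal_pos hs hs'
  have hC' : ∀ᵐ τ ∂ν, ∫⁻ x, ‖H (x, τ)‖ₑ ^ s.toReal ∂μ ≤ C ^ s.toReal := by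
    filter_upwards [hC] with τ hτ
    rwa [eLpNorm_eq_lintegral_rpow_enorm_toReal hs hs', one_div,
      ENNReal.rpow_inv_le_iff hr] at hτ
  calc ∫⁻ x, ∫⁻ τ, ‖H (x, τ)‖ₑ ^ s.toReal ∂ν ∂μ
      = ∫⁻ τ, ∫⁻ x, ‖H (x, τ)‖ₑ ^ s.toReal ∂μ ∂ν :=
        lintegral_lintegral_swap (hH.enorm.pow_const _)
    _ ≤ ∫⁻ _, C ^ s.toReal ∂ν := lintegral_mono_ae hC'
    _ = C ^ s.toReal := by simp

lemma ae_ae_enorm_le_of_eLpNormEssSup_le [SFinite ν] (hH : AEStronglyMeasurable H (μ.prod ν))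
    (hC : ∀ᵐ τ ∂ν, eLpNormEssSup (fun x => H (x, τ)) μ ≤ C) :
    ∀ᵐ x ∂μ, ∀ᵐ τ ∂ν, ‖H (x, τ)‖ₑ ≤ C := by
  have hswap : ∀ᵐ τ ∂ν, ∀ᵐ x ∂μ, H (x, τ) = hH.mk H (x, τ) :=
    Measure.ae_ae_of_ae_prod
      ((Measure.measurePreserving_swap (μ := ν) (ν := μ)).quasiMeasurePreserving.ae hH.ae_eq_mk)
  have hmeas : MeasurableSet {z : X × T | ‖hH.mk H z‖ₑ ≤ C} :=
    measurableSet_le hH.stronglyMeasurable_mk.enorm measurable_const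
  have hmk : ∀ᵐ x ∂μ, ∀ᵐ τ ∂ν, ‖hH.mk H (x, τ)‖ₑ ≤ C := by
    refine (Measure.ae_ae_comm hmeas).2 ?_
    filter_upwards [hC, hswap] with τ hτ hHτ
    filter_upwards [ae_le_eLpNormEssSup (f := fun x => H (x, τ)), hHτ] with x hx hHx
    exact hHx ▸ hx.trans hτ
  filter_upwards [hmk, Measure.ae_ae_of_ae_prod hH.ae_eq_mk] with x hx hHx
  filter_upwards [hx, hHx] with τ hτ hHτ
  rwa [hHτ]

lemma eLpNorm_integral_le_of_ae_le [IsProbabilityMeasure ν] [NormedSpace ℝ E] (hs : 1 ≤ s)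
    (hH : AEStronglyMeasurable H (μ.prod ν))
    (hC : ∀ᵐ τ ∂ν, eLpNorm (fun x => H (x, τ)) s μ ≤ C) :
    eLpNorm (fun x => ∫ τ, H (x, τ) ∂ν) s μ ≤ C := by
  rcases eq_or_ne s ∞ with rfl | hs'
  · simp only [eLpNorm_exponent_top] at hC ⊢
    refine eLpNormEssSup_le_of_ae_enorm_bound ?_
    filter_upwards [ae_ae_enorm_le_of_eLpNormEssSup_le hH hC] with x hx
    calc ‖∫ τ, H (x, τ) ∂ν‖ₑ ≤ ∫⁻ τ, ‖H (x, τ)‖ₑ ∂ν := enorm_integral_le_lintegral_enorm _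
      _ ≤ ∫⁻ _, C ∂ν := lintegral_mono_ae hx
      _ = C := by simp
  have hs0 : s ≠ 0 := (zero_lt_one.trans_le hs).ne'
  have hr : 0 < s.toReal := ENNReal.toReal_pos hs0 hs'
  have hJensen : ∀ᵐ x ∂μ,
      ‖∫ τ, H (x, τ) ∂ν‖ₑ ^ s.toReal ≤ ∫⁻ τ, ‖H (x, τ)‖ₑ ^ s.toReal ∂ν := by
    filter_upwards [hH.prodMk_left] with x hx
    have h := eLpNorm_le_eLpNorm_of_exponent_le hs hx
    rw [eLpNorm_one_eq_lintegral_enorm, eLpNorm_eq_lintegral_rpow_enorm_toReal hs0 hs',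
      one_div, ENNReal.le_rpow_inv_iff hr] at h
    exact (ENNReal.rpow_le_rpow (enorm_integral_le_lintegral_enorm _) hr.le).trans h
  rw [eLpNorm_eq_lintegral_rpow_enorm_toReal hs0 hs', one_div, ENNReal.rpow_inv_le_iff hr]
  exact (lintegral_mono_ae hJensen).trans (lintegral_lintegral_rpow_enorm_le hs0 hs' hH hC)

end Minkowski

section AbsolutelyContinuous

lemma disjoint_uIoc_of_monotone {α β : Type*} [LinearOrder α] [LinearOrder β] {φ : α → β}
    (hφ : Monotone φ) {a b c d : α} (h : Disjoint (Set.uIoc a b) (Set.uIoc c d)) :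
    Disjoint (Set.uIoc (φ a) (φ b)) (Set.uIoc (φ c) (φ d)) := by
  simp only [Set.uIoc, Set.Ioc_disjoint_Ioc, ← hφ.map_min, ← hφ.map_max] at h ⊢
  exact hφ h

lemma absolutelyContinuousOnInterval_comp_of_monotone_of_lipschitzWith {X : Type*}
    [PseudoMetricSpace X] {f : ℝ → X} {φ : ℝ → ℝ} {a b c d : ℝ} {K : NNReal}
    (hf : AbsolutelyContinuousOnInterval f a b) (hmono : Monotone φ) (hφ : LipschitzWith K φ)
    (hmaps : Set.MapsTo φ (Set.uIcc c d) (Set.uIcc a b)) :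
    AbsolutelyContinuousOnInterval (f ∘ φ) c d := by
  rw [absolutelyContinuousOnInterval_iff] at hf ⊢
  intro ε hε
  obtain ⟨δ, hδ, hf⟩ := hf ε hε
  refine ⟨δ / (K + 1), by positivity, fun I hI hsum => ?_⟩
  refine hf (I.1, fun i => (φ (I.2 i).1, φ (I.2 i).2)) ⟨fun i hi => ?_, ?_⟩ ?_
  · exact ⟨hmaps (hI.1 i hi).1, hmaps (hI.1 i hi).2⟩
  · exact fun i hi j hj hij => disjoint_uIoc_of_monotone hmono (hI.2 hi hj hij)
  · calc ∑ i ∈ Finset.range I.1, dist (φ (I.2 i).1) (φ (I.2 i).2)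
        ≤ ∑ i ∈ Finset.range I.1, (K + 1) * dist (I.2 i).1 (I.2 i).2 := by
          gcongr with i
          exact (hφ.dist_le_mul _ _).trans (by gcongr; simp)
      _ = (K + 1) * ∑ i ∈ Finset.range I.1, dist (I.2 i).1 (I.2 i).2 := by rw [Finset.mul_sum]
      _ < δ := by rwa [lt_div_iff₀' (by positivity)] at hsum

/-- The concatenation of two paths parametrized by `[0, 1]`, each run at double speed. -/
def concatCurve {X : Type*} (γ₁ γ₂ : ℝ → X) (τ : ℝ) : X :=
  if τ ≤ 1 / 2 then γ₁ (2 * τ) else γ₂ (2 * τ - 1)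

lemma absolutelyContinuousOnInterval_concatCurve {E : Type*} [NormedAddCommGroup E] {γ₁ γ₂ : ℝ → E}
    (h₁ : AbsolutelyContinuousOnInterval γ₁ 0 1) (h₂ : AbsolutelyContinuousOnInterval γ₂ 0 1)
    (h : γ₁ 1 = γ₂ 0) : AbsolutelyContinuousOnInterval (concatCurve γ₁ γ₂) 0 1 := by
  have hconcat : concatCurve γ₁ γ₂ =
      γ₁ ∘ (fun τ => min (2 * τ) 1) + γ₂ ∘ (fun τ => max (2 * τ - 1) 0) - fun _ => γ₂ 0 := by
    ext τ
    rcases le_or_gt τ (1 / 2) with hτ | hτ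
    · simp only [concatCurve, if_pos hτ, Pi.sub_apply, Pi.add_apply, Function.comp_apply,
        min_eq_left (by linarith : 2 * τ ≤ 1),
        max_eq_right (by linarith : 2 * τ - 1 ≤ 0), add_sub_cancel_right]
    · simp only [concatCurve, if_neg hτ.not_ge, Pi.sub_apply, Pi.add_apply, Function.comp_apply,
        min_eq_right (by linarith : 1 ≤ 2 * τ),
        max_eq_left (by linarith : 0 ≤ 2 * τ - 1), h,
        add_sub_cancel_left]
  have hdouble : LipschitzWith 2 fun τ : ℝ => 2 * τ := by
    simpa using lipschitzWith_smul (β := ℝ) (2 : ℝ)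
  rw [hconcat]
  refine ((absolutelyContinuousOnInterval_comp_of_monotone_of_lipschitzWith h₁
    (fun x y hxy => by gcongr) (hdouble.min_const 1) fun τ hτ => ?_).add
    (absolutelyContinuousOnInterval_comp_of_monotone_of_lipschitzWith h₂
    (fun x y hxy => by gcongr)
    ((hdouble.sub (LipschitzWith.const (1 : ℝ))).max_const 0) fun τ hτ => ?_)).sub
    (LipschitzWith.const (γ₂ 0)).lipschitzOnWith.absolutelyContinuousOnInterval
  all_goals
    rw [Set.uIcc_of_le zero_le_one] at hτ ⊢
    constructor <;> grind

end AbsolutelyContinuous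

lemma measurePreserving_mul_left_add {a : ℝ} (ha : a ≠ 0) (b : ℝ) :
    MeasurePreserving (fun x : ℝ => a * x + b) (ENNReal.ofReal |a| • volume) volume :=
  (measurePreserving_add_right volume b).comp
    ⟨by fun_prop, by rw [Measure.map_smul, Real.smul_map_volume_mul_left ha]⟩

section LocallyIntegrable

variable {X : Type*} [TopologicalSpace X] [MeasurableSpace X] {μ : Measure X} {U : Set X}
  {g φ : X → ℝ}

lemma setIntegral_mul_eq_integral (hφU : tsupport φ ⊆ U) :
    ∫ x in U, g x * φ x ∂μ = ∫ x, g x * φ x ∂μ :=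
  setIntegral_eq_integral_of_forall_compl_eq_zero fun x hx => by
    rw [image_eq_zero_of_notMem_tsupport fun h => hx (hφU h), mul_zero]

variable [T2Space X] [OpensMeasurableSpace X]

lemma integrable_mul_of_tsupport_subset (hg : LocallyIntegrableOn g U μ) (hφ : Continuous φ)
    (hφc : HasCompactSupport φ) (hφU : tsupport φ ⊆ U) : Integrable (fun x => g x * φ x) μ := by
  rw [← integrableOn_iff_integrable_of_support_subset (s := tsupport φ)]
  · exact (hg.integrableOn_compact_subset hφU hφc).mul_continuousOn hφ.continuousOn hφc
  · exact fun x hx => subset_tsupport _ (right_ne_zero_of_mul hx)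

lemma locallyIntegrableOn_of_integrable_mul [LocallyCompactSpace X] (hU : IsOpen U)
    (hg : ∀ φ : X → ℝ, Continuous φ → HasCompactSupport φ → tsupport φ ⊆ U →
      Integrable (fun x => g x * φ x) μ) : LocallyIntegrableOn g U μ := by
  refine (locallyIntegrableOn_iff hU.isLocallyClosed).2 fun K hKU hK => ?_
  obtain ⟨φ, hφK, hφc, hφU, -⟩ := exists_continuousMap_one_of_isCompact_subset_isOpen hK hU hKU
  refine ((hg φ φ.continuous hφc hφU).integrableOn (s := K)).congr_fun (fun x hx => ?_) ?_
  · simp [hφK hx]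
  · exact hK.measurableSet

lemma ae_eq_restrict_of_integral_mul_eq {E : Type*} [NormedAddCommGroup E] [NormedSpace ℝ E]
    [FiniteDimensional ℝ E] [MeasurableSpace E] [BorelSpace E] {μ : Measure E} {U : Set E}
    {g g' : E → ℝ} (hU : IsOpen U) (hg : LocallyIntegrableOn g U μ)
    (hg' : LocallyIntegrableOn g' U μ)
    (h : ∀ φ : E → ℝ, ContDiff ℝ ((⊤ : ℕ∞) : WithTop ℕ∞) φ → HasCompactSupport φ →
      tsupport φ ⊆ U → ∫ x, g x * φ x ∂μ = ∫ x, g' x * φ x ∂μ) :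
    g =ᵐ[μ.restrict U] g' := by
  have hsub : ∀ᵐ x ∂μ, x ∈ U → (g - g') x = 0 :=
    hU.ae_eq_zero_of_integral_contDiff_smul_eq_zero (hg.sub hg') fun φ hφ hφc hφU => by
      have hi := integrable_mul_of_tsupport_subset hg hφ.continuous hφc hφU
      have hi' := integrable_mul_of_tsupport_subset hg' hφ.continuous hφc hφU
      simp only [Pi.sub_apply, smul_eq_mul, mul_comm (φ _), sub_mul]
      rw [integral_sub hi hi', h φ hφ hφc hφU, sub_self]
  filter_upwards [ae_restrict_of_ae hsub, ae_restrict_mem hU.measurableSet] with x hx hxU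
  exact sub_eq_zero.1 (hx hxU)

end LocallyIntegrable

namespace Heisenberg

variable {n : ℕ}

/-- The bilinear form `(u, v) ↦ 2 ∑ j, (v_{x_j} u_{y_j} - u_{x_j} v_{y_j})` on `ℝ^{2n}` by which the
group law differs from addition. -/
def symp : Hor n →L[ℝ] Hor n →L[ℝ] ℝ :=
  (2 : ℝ) • ∑ j : Fin n,
    ((EuclideanSpace.proj (Sum.inr j) : Hor n →L[ℝ] ℝ).smulRight
        (EuclideanSpace.proj (Sum.inl j) : Hor n →L[ℝ] ℝ) -
      (EuclideanSpace.proj (Sum.inl j) : Hor n →L[ℝ] ℝ).smulRight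
        (EuclideanSpace.proj (Sum.inr j) : Hor n →L[ℝ] ℝ))

lemma symp_apply (u v : Hor n) :
    symp u v =
      2 * ∑ j : Fin n, (v (Sum.inl j) * u (Sum.inr j) - u (Sum.inl j) * v (Sum.inr j)) := by
  simp [symp, mul_comm]

lemma symp_swap (u v : Hor n) : symp v u = -symp u v := by
  simp only [symp_apply, ← mul_neg, ← Finset.sum_neg_distrib]
  congr! 2
  ring

@[simp] lemma symp_self (u : Hor n) : symp u u = 0 := by
  linarith [symp_swap u u]

lemma symp_single (i : Fin n) (a b : ℝ) :
    symp (EuclideanSpace.single (Sum.inl i) a) (EuclideanSpace.single (Sum.inr i) b) =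
      -(2 * (a * b)) := by
  simp [symp_apply]

lemma mul_eq (p q : Heis n) : mul p q = (p.1 + q.1, p.2 + q.2 + symp p.1 q.1) := by
  rw [symp_apply, mul]

protected lemma mul_assoc (p q r : Heis n) : mul (mul p q) r = mul p (mul q r) := by
  ext1
  · simp [mul_eq, add_assoc]
  · simp only [mul_eq, map_add, add_apply]
    ring

@[simp] protected lemma mul_zero (p : Heis n) : mul p 0 = p := by
  simp [mul_eq]

@[simp] protected lemma mul_neg_cancel_right (p q : Heis n) : mul (mul p q) (-q) = p := by
  rw [Heisenberg.mul_assoc, show mul q (-q) = 0 by simp [mul_eq], Heisenberg.mul_zero]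

lemma contDiff_mul_right (q : Heis n) {k : WithTop ℕ∞} : ContDiff ℝ k fun p => mul p q := by
  simp only [mul_eq]
  fun_prop

@[fun_prop]
protected lemma continuous_mul {X : Type*} [TopologicalSpace X] {a b : X → Heis n}
    (ha : Continuous a) (hb : Continuous b) : Continuous fun x => mul (a x) (b x) := by
  simp only [mul_eq]
  fun_prop

@[simp] protected lemma mul_neg_mul_cancel (p q : Heis n) : mul (mul p (-q)) q = p := by
  simpa using Heisenberg.mul_neg_cancel_right p (-q)

/-- Right translation by `q` as a homeomorphism. -/
def rightMul (q : Heis n) : Heis n ≃ₜ Heis n where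
  toFun p := mul p q
  invFun p := mul p (-q)
  left_inv p := Heisenberg.mul_neg_cancel_right p q
  right_inv p := Heisenberg.mul_neg_mul_cancel p q

/-- The exponential of the left-invariant vector field `∑ j, v j • Z j`. -/
def hexp (v : Hor n) : Heis n := (v, 0)

/-- The left-invariant vector field `∑ j, v j • Z j`. -/
def horizontalField (v : Hor n) (p : Heis n) : Heis n := (v, symp p.1 v)

@[fun_prop]
lemma continuous_hexp {X : Type*} [TopologicalSpace X] {a : X → Hor n} (ha : Continuous a) :
    Continuous fun x => hexp (a x) := by
  unfold hexp
  fun_prop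

@[fun_prop]
lemma continuous_horizontalField (v : Hor n) : Continuous (horizontalField v) := by
  unfold horizontalField
  fun_prop

@[simp] lemma hexp_zero : hexp (0 : Hor n) = 0 := rfl

lemma sum_mul_vertCoeff (p : Heis n) (v : Hor n) : ∑ j, v j * vertCoeff j p = symp p.1 v := by
  simp only [symp_apply, vertCoeff, Fintype.sum_sum_type, Finset.mul_sum, ← Finset.sum_add_distrib]
  congr! 1
  ring

lemma sum_smul_Z (v : Hor n) (p : Heis n) : ∑ j, v j • Z j p = horizontalField v p := by
  ext1
  · ext i
    simp [Z, horizontalField, Prod.fst_sum, Finset.sum_apply, Pi.single_apply,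
      -Fintype.sum_sum_type]
  · simp [Z, horizontalField, Prod.snd_sum, ← sum_mul_vertCoeff, -Fintype.sum_sum_type]

lemma horizontalField_mem_horizontalSpace (v : Hor n) (p : Heis n) :
    horizontalField v p ∈ horizontalSpace p := by
  rw [← sum_smul_Z]
  exact Submodule.sum_mem _ fun j _ => Submodule.smul_mem _ _ (Submodule.subset_span ⟨j, rfl⟩)

lemma mul_hexp_smul (p : Heis n) (c : ℝ) (v : Hor n) :
    mul p (hexp (c • v)) = p + c • horizontalField v p := by
  simp [mul_eq, hexp, horizontalField, Prod.ext_iff]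

lemma mul_hexp (p : Heis n) (v : Hor n) : mul p (hexp v) = p + horizontalField v p := by
  simpa using mul_hexp_smul p 1 v

lemma horizontalField_mul_hexp_smul (v : Hor n) (p : Heis n) (c : ℝ) :
    horizontalField v (mul p (hexp (c • v))) = horizontalField v p := by
  simp [mul_eq, hexp, horizontalField]

lemma mul_neg_hexp_smul (p : Heis n) (c : ℝ) (v : Hor n) :
    mul p (-hexp (c • v)) = p - c • horizontalField v p := by
  simpa [hexp, sub_eq_add_neg] using mul_hexp_smul p (-c) v

lemma mul_add_smul_horizontalField {q : Heis n} {v : Hor n} (hq : symp q.1 v = 0) (p : Heis n)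
    (c : ℝ) :
    mul (p + c • horizontalField v p) q = mul p q + c • horizontalField v (mul p q) := by
  ext1
  · simp [mul_eq, horizontalField, add_right_comm]
  · simp only [horizontalField, Prod.smul_mk, smul_eq_mul, mul_eq, Prod.fst_add, Prod.snd_add,
      map_add, map_smul, add_apply, smul_apply, symp_swap q.1 v, hq, neg_zero, mul_zero, add_zero,
      Prod.mk_add_mk]
    ring

lemma dil_mul (r : ℝ) (p q : Heis n) : dil r (mul p q) = mul (dil r p) (dil r q) := by
  ext1
  · simp [dil, mul_eq]
  · simp only [dil, mul_eq, map_smul, smul_apply, smul_eq_mul]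
    ring

lemma dil_hexp (r : ℝ) (v : Hor n) : dil r (hexp v) = hexp (r • v) := by
  simp [dil, hexp]

section RightTranslation

variable {E : Type*} [NormedAddCommGroup E] {s : ℝ≥0∞}

lemma measurePreserving_mul_right (q : Heis n) :
    MeasurePreserving (fun p : Heis n => mul p q) volume volume := by
  simp only [Measure.volume_eq_prod, mul_eq]
  refine MeasurePreserving.skew_product (g := fun x t => t + q.2 + symp x q.1)
    (measurePreserving_add_right volume q.1) ?_ (ae_of_all _ fun x => ?_)
  · exact Continuous.measurable (by unfold Function.uncurry; fun_prop)
  · simpa only [add_assoc] using (measurePreserving_add_right volume (q.2 + symp x q.1)).map_eq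

lemma eLpNorm_comp_mul_right_restrict_le {g : Heis n → E} {q : Heis n} {S S' : Set (Heis n)}
    (hS : Set.MapsTo (fun p => mul p q) S S') :
    eLpNorm (fun p => g (mul p q)) s (volume.restrict S) ≤ eLpNorm g s (volume.restrict S') := by
  have hpres := (measurePreserving_mul_right q).restrict_preimage_emb
    (rightMul q).measurableEmbedding S'
  calc eLpNorm (fun p => g (mul p q)) s (volume.restrict S)
      ≤ eLpNorm (fun p => g (mul p q)) s (volume.restrict ((fun p => mul p q) ⁻¹' S')) :=
        eLpNorm_mono_measure _ (Measure.restrict_mono hS le_rfl)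
    _ = eLpNorm g s (Measure.map (rightMul q) (volume.restrict ((fun p => mul p q) ⁻¹' S'))) :=
        ((rightMul q).measurableEmbedding.eLpNorm_map_measure).symm
    _ = eLpNorm g s (volume.restrict S') := by rw [← hpres.map_eq]; rfl

lemma tendsto_eLpNorm_mul_right_sub (hs : 1 ≤ s) (hs' : s ≠ ∞) {g : Heis n → E}
    (hg : MemLp g s volume) :
    Tendsto (fun q : Heis n => eLpNorm (fun p => g (mul p q) - g p) s volume) (𝓝 0) (𝓝 0) := by
  have : Fact (1 ≤ s) := ⟨hs⟩
  let Φ : C(Heis n, C(Heis n, Heis n)) :=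
    ContinuousMap.curry ⟨fun z : Heis n × Heis n => mul z.2 z.1, by fun_prop⟩
  have hΦ : ∀ q, MeasurePreserving (Φ q) volume volume := measurePreserving_mul_right
  have hcomp : ∀ q, Lp.compMeasurePreserving (Φ q) (hΦ q) (hg.toLp g)
      =ᵐ[volume] fun p => g (mul p q) := fun q =>
    (Lp.coeFn_compMeasurePreserving _ (hΦ q)).trans
      ((hΦ q).quasiMeasurePreserving.ae_eq_comp hg.coeFn_toLp)
  have hlim := Filter.Tendsto.compMeasurePreservingLp (f := fun _ : Heis n => hg.toLp g)
    (g := Φ) (l := 𝓝 0) (g₀ := Φ 0) tendsto_const_nhds Φ.continuous.continuousAt hΦ (hΦ 0) hs'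
  rw [tendsto_iff_edist_tendsto_0] at hlim
  refine hlim.congr fun q => ?_
  rw [Lp.edist_def]
  refine eLpNorm_congr_ae ?_
  filter_upwards [hcomp q, hcomp 0] with p hq h0
  rw [Pi.sub_apply, hq, h0, Heisenberg.mul_zero]

end RightTranslation

section CarnotCaratheodory

lemma sqrt_metric_horizontalField (v : Hor n) (p : Heis n) :
    √(metric p (horizontalField v p) (horizontalField v p)) = ‖v‖ := by
  simp [metric, tComponent, sum_mul_vertCoeff, horizontalField, -Fintype.sum_sum_type]

lemma sqrt_metric_smul (p v : Heis n) (c : ℝ) :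
    √(metric p (c • v) (c • v)) = |c| * √(metric p v v) := by
  have htc : tComponent p (c • v) = c * tComponent p v := by
    simp only [tComponent, sum_mul_vertCoeff, Prod.smul_fst, Prod.smul_snd, map_smul, smul_eq_mul]
    ring
  have hmetric : metric p (c • v) (c • v) = c ^ 2 * metric p v v := by
    simp only [metric, htc, Prod.smul_fst, real_inner_smul_left, real_inner_smul_right]
    ring
  rw [hmetric, Real.sqrt_mul (sq_nonneg c), Real.sqrt_sq_eq_abs]

/-- The speed of a curve; its integral over `[0, 1]` is `curveLength`. -/
def speed (γ : ℝ → Heis n) (τ : ℝ) : ℝ≥0∞ :=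
  ENNReal.ofReal (√(metric (γ τ) (deriv γ τ) (deriv γ τ)))

section Reparametrization

variable {γ c : ℝ → Heis n} {a b : ℝ}

lemma deriv_eq_smul_of_eqOn_affine {U : Set ℝ} (hU : IsOpen U)
    (hc : Set.EqOn c (fun τ => γ (a * τ + b)) U) {τ : ℝ} (hτ : τ ∈ U) :
    deriv c τ = a • deriv γ (a * τ + b) := by
  rw [(hc.eventuallyEq_of_mem (hU.mem_nhds hτ)).deriv_eq,
    deriv_comp_mul_left a (fun x => γ (x + b)), deriv_comp_add_const]

lemma setLIntegral_speed_of_eqOn_affine (ha : a ≠ 0)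
    (hc : Set.EqOn c (fun τ => γ (a * τ + b)) ((fun τ => a * τ + b) ⁻¹' Set.Ioo 0 1)) :
    ∫⁻ τ in (fun τ => a * τ + b) ⁻¹' Set.Ioo 0 1, speed c τ = curveLength γ := by
  have hopen : IsOpen ((fun τ => a * τ + b) ⁻¹' Set.Ioo 0 1) := isOpen_Ioo.preimage (by fun_prop)
  have hemb : MeasurableEmbedding fun τ : ℝ => a * τ + b :=
    (measurableEmbedding_addRight b).comp (measurableEmbedding_mulLeft₀ ha)
  calc ∫⁻ τ in (fun τ => a * τ + b) ⁻¹' Set.Ioo 0 1, speed c τ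
      = ∫⁻ τ in (fun τ => a * τ + b) ⁻¹' Set.Ioo 0 1,
          ENNReal.ofReal |a| * speed γ (a * τ + b) := by
        refine setLIntegral_congr_fun hopen.measurableSet fun τ hτ => ?_
        rw [speed, deriv_eq_smul_of_eqOn_affine hopen hc hτ, hc hτ, sqrt_metric_smul,
          ENNReal.ofReal_mul (abs_nonneg a), speed]
    _ = ∫⁻ τ in (fun τ => a * τ + b) ⁻¹' Set.Ioo 0 1,
          speed γ (a * τ + b) ∂(ENNReal.ofReal |a| • volume) := by
        rw [Measure.restrict_smul, lintegral_smul_measure, smul_eq_mul,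
          lintegral_const_mul' _ _ ENNReal.ofReal_ne_top]
    _ = ∫⁻ σ in Set.Ioo 0 1, speed γ σ :=
        (measurePreserving_mul_left_add ha b).setLIntegral_comp_preimage_emb hemb _ _
    _ = curveLength γ := by rw [restrict_Ioo_eq_restrict_Icc]; rfl

lemma ae_deriv_mem_horizontalSpace_of_eqOn_affine (ha : a ≠ 0) (hγ : IsHorizontalCurve γ)
    (hc : Set.EqOn c (fun τ => γ (a * τ + b)) ((fun τ => a * τ + b) ⁻¹' Set.Ioo 0 1)) :
    ∀ᵐ τ ∂volume.restrict ((fun τ => a * τ + b) ⁻¹' Set.Ioo 0 1),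
      deriv c τ ∈ horizontalSpace (c τ) := by
  have hopen : IsOpen ((fun τ => a * τ + b) ⁻¹' Set.Ioo 0 1) := isOpen_Ioo.preimage (by fun_prop)
  have hpres := (measurePreserving_mul_left_add ha b).restrict_preimage
    (measurableSet_Ioo (a := (0 : ℝ)) (b := 1))
  have hγ' := hpres.quasiMeasurePreserving.ae
    (restrict_Ioo_eq_restrict_Icc (μ := volume (α := ℝ)) ▸ hγ.2)
  rw [Measure.restrict_smul, Measure.ae_ennreal_smul_measure_iff (by simpa using ha)] at hγ'
  filter_upwards [hγ', ae_restrict_mem hopen.measurableSet] with τ hτ hmem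
  rw [deriv_eq_smul_of_eqOn_affine hopen hc hmem, hc hmem]
  exact Submodule.smul_mem _ _ hτ

end Reparametrization

lemma restrict_Icc_zero_one_eq_add_halves :
    (volume.restrict (Set.Icc (0 : ℝ) 1)) =
      volume.restrict ((fun τ => 2 * τ + 0) ⁻¹' Set.Ioo 0 1) +
        volume.restrict ((fun τ => 2 * τ + (-1)) ⁻¹' Set.Ioo 0 1) := by
  have hleft : (fun τ : ℝ => 2 * τ + 0) ⁻¹' Set.Ioo 0 1 = Set.Ioo 0 (1 / 2) := by ext; grind
  have hright : (fun τ : ℝ => 2 * τ + (-1)) ⁻¹' Set.Ioo 0 1 = Set.Ioo (1 / 2) 1 := by ext; grind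
  rw [hleft, hright, Measure.restrict_congr_set Ioo_ae_eq_Icc,
    Measure.restrict_congr_set Ioo_ae_eq_Ioc, ← Measure.restrict_union
      (Set.disjoint_left.2 fun x hx hy => hy.1.not_ge hx.2) measurableSet_Ioc,
    Set.Icc_union_Ioc_eq_Icc (by norm_num) (by norm_num)]

section Concatenation

variable {γ₁ γ₂ : ℝ → Heis n}

lemma concatCurve_eqOn_left :
    Set.EqOn (concatCurve γ₁ γ₂) (fun τ => γ₁ (2 * τ + 0))
      ((fun τ => 2 * τ + 0) ⁻¹' Set.Ioo 0 1) := fun τ hτ => by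
  simp only [concatCurve, if_pos (by linarith [hτ.2] : τ ≤ 1 / 2), add_zero]

lemma concatCurve_eqOn_right :
    Set.EqOn (concatCurve γ₁ γ₂) (fun τ => γ₂ (2 * τ + (-1)))
      ((fun τ => 2 * τ + (-1)) ⁻¹' Set.Ioo 0 1) := fun τ hτ => by
  simp only [concatCurve, if_neg (by linarith [hτ.1] : ¬τ ≤ 1 / 2), sub_eq_add_neg]

lemma IsHorizontalCurve.concatCurve (h₁ : IsHorizontalCurve γ₁) (h₂ : IsHorizontalCurve γ₂)
    (h : γ₁ 1 = γ₂ 0) : IsHorizontalCurve (concatCurve γ₁ γ₂) := by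
  refine ⟨absolutelyContinuousOnInterval_concatCurve h₁.1 h₂.1 h, ?_⟩
  rw [restrict_Icc_zero_one_eq_add_halves, ae_add_measure_iff]
  exact ⟨ae_deriv_mem_horizontalSpace_of_eqOn_affine two_ne_zero h₁ concatCurve_eqOn_left,
    ae_deriv_mem_horizontalSpace_of_eqOn_affine two_ne_zero h₂ concatCurve_eqOn_right⟩

lemma curveLength_concatCurve (γ₁ γ₂ : ℝ → Heis n) :
    curveLength (concatCurve γ₁ γ₂) = curveLength γ₁ + curveLength γ₂ := by
  calc curveLength (concatCurve γ₁ γ₂)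
      = ∫⁻ τ in Set.Icc 0 1, speed (concatCurve γ₁ γ₂) τ := rfl
    _ = curveLength γ₁ + curveLength γ₂ := by
        rw [restrict_Icc_zero_one_eq_add_halves, lintegral_add_measure,
          setLIntegral_speed_of_eqOn_affine two_ne_zero concatCurve_eqOn_left,
          setLIntegral_speed_of_eqOn_affine two_ne_zero concatCurve_eqOn_right]

end Concatenation

lemma ccDist_le_curveLength {γ : ℝ → Heis n} (hγ : IsHorizontalCurve γ) :
    ccDist (γ 0) (γ 1) ≤ curveLength γ :=
  iInf₂_le_of_le γ hγ (iInf₂_le_of_le rfl rfl le_rfl)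

lemma ccDist_triangle (p q r : Heis n) : ccDist p r ≤ ccDist p q + ccDist q r := by
  simp only [ccDist, ENNReal.iInf_add, ENNReal.add_iInf]
  refine le_iInf₂ fun γ₂ h₂ => le_iInf₂ fun h₂q h₂r => le_iInf₂ fun γ₁ h₁ =>
    le_iInf₂ fun h₁p h₁q => ?_
  rw [← curveLength_concatCurve]
  refine iInf₂_le_of_le (concatCurve γ₁ γ₂) (h₁.concatCurve h₂ (h₁q.trans h₂q.symm))
    (iInf₂_le_of_le ?_ ?_ le_rfl)
  · simp [concatCurve, h₁p]
  · norm_num [concatCurve, h₂r]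

lemma ccDist_mul_hexp_le (p : Heis n) (v : Hor n) :
    ccDist p (mul p (hexp v)) ≤ ENNReal.ofReal ‖v‖ := by
  let γ : ℝ → Heis n := fun τ => p + τ • horizontalField v p
  have hderiv : ∀ τ, deriv γ τ = horizontalField v (γ τ) := fun τ => by
    rw [show γ τ = mul p (hexp (τ • v)) from (mul_hexp_smul p τ v).symm,
      horizontalField_mul_hexp_smul]
    simpa only [one_smul] using
      (((hasDerivAt_id' τ).smul_const (horizontalField v p)).const_add p).deriv
  have hγ : IsHorizontalCurve γ :=
    ⟨ContDiffOn.absolutelyContinuousOnInterval (by fun_prop), ae_of_all _ fun τ => by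
      rw [hderiv]
      exact horizontalField_mem_horizontalSpace v _⟩
  have hspeed : ∀ τ, speed γ τ = ENNReal.ofReal ‖v‖ := fun τ => by
    rw [speed, hderiv, sqrt_metric_horizontalField]
  calc ccDist p (mul p (hexp v))
      = ccDist (γ 0) (γ 1) := by simp [γ, mul_hexp]
    _ ≤ curveLength γ := ccDist_le_curveLength hγ
    _ = ∫⁻ _ in Set.Icc (0 : ℝ) 1, ENNReal.ofReal ‖v‖ := lintegral_congr hspeed
    _ = ENNReal.ofReal ‖v‖ := by simp

end CarnotCaratheodory

section Paths

/-- The endpoint of the concatenation of the horizontal segments with velocities in `l`, starting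
from the origin. -/
def endpoint : List (Hor n) → Heis n
  | [] => 0
  | v :: l => mul (hexp v) (endpoint l)

/-- The length of the concatenation of the horizontal segments with velocities in `l`. -/
def pathLength (l : List (Hor n)) : ℝ := (l.map (‖·‖)).sum

lemma pathLength_nonneg (l : List (Hor n)) : 0 ≤ pathLength l :=
  List.sum_nonneg fun x hx => by
    obtain ⟨v, _, rfl⟩ := List.mem_map.1 hx
    exact norm_nonneg v

@[simp] lemma pathLength_nil : pathLength ([] : List (Hor n)) = 0 := rfl

@[simp] lemma pathLength_cons (v : Hor n) (l : List (Hor n)) :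
    pathLength (v :: l) = ‖v‖ + pathLength l := by
  simp [pathLength]

lemma pathLength_map_smul {ε : ℝ} (hε : 0 ≤ ε) (l : List (Hor n)) :
    pathLength (l.map (ε • ·)) = ε * pathLength l := by
  induction l with
  | nil => simp
  | cons v l ih => simp [ih, norm_smul, abs_of_nonneg hε, mul_add]

lemma endpoint_map_smul (ε : ℝ) (l : List (Hor n)) :
    endpoint (l.map (ε • ·)) = dil ε (endpoint l) := by
  induction l with
  | nil => simp [endpoint, dil, Prod.ext_iff]
  | cons v l ih => simp only [List.map_cons, endpoint, ih, dil_mul, dil_hexp]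

/-- The points from which the horizontal segment with velocity `v` stays in `Ω`. -/
def segmentDomain (Ω : Set (Heis n)) (v : Hor n) : Set (Heis n) :=
  {p | ∀ τ ∈ Set.Icc (0 : ℝ) 1, mul p (hexp (τ • v)) ∈ Ω}

/-- The points from which the concatenation of the horizontal segments with velocities in `l` stays
in `Ω`. -/
def pathDomain (Ω : Set (Heis n)) : List (Hor n) → Set (Heis n)
  | [] => Ω
  | v :: l => segmentDomain Ω v ∩ {p | mul p (hexp v) ∈ pathDomain Ω l}

variable {Ω : Set (Heis n)}

lemma segmentDomain_subset (v : Hor n) : segmentDomain Ω v ⊆ Ω := fun p hp => by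
  simpa using hp 0 (by simp)

lemma mul_hexp_mem {v : Hor n} {p : Heis n} (hp : p ∈ segmentDomain Ω v) :
    mul p (hexp v) ∈ Ω := by
  simpa using hp 1 (by simp)

lemma isOpen_segmentDomain (hΩ : IsOpen Ω) (v : Hor n) : IsOpen (segmentDomain Ω v) := by
  refine isOpen_iff_mem_nhds.2 fun p hp => isCompact_Icc.eventually_forall_of_forall_eventually
    fun τ hτ => ?_
  have hcont : Continuous fun z : Heis n × ℝ => mul z.1 (hexp (z.2 • v)) := by fun_prop
  exact hcont.continuousAt.eventually_mem (hΩ.mem_nhds (hp τ hτ))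

lemma pathDomain_subset : ∀ l : List (Hor n), pathDomain Ω l ⊆ Ω
  | [] => subset_rfl
  | v :: _ => Set.inter_subset_left.trans (segmentDomain_subset v)

lemma mul_endpoint_mem {l : List (Hor n)} {p : Heis n} (hp : p ∈ pathDomain Ω l) :
    mul p (endpoint l) ∈ Ω := by
  induction l generalizing p with
  | nil => simpa [endpoint, pathDomain] using hp
  | cons v l ih =>
    rw [endpoint, ← Heisenberg.mul_assoc]
    exact ih hp.2

lemma exists_mul_hexp_mem_frontier {p : Heis n} (hp : p ∈ Ω) {v : Hor n}
    (hv : p ∉ segmentDomain Ω v) :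
    ∃ τ ∈ Set.Icc (0 : ℝ) 1, mul p (hexp (τ • v)) ∈ frontier Ω := by
  obtain ⟨σ, hσ, hσΩ⟩ : ∃ σ ∈ Set.Icc (0 : ℝ) 1, mul p (hexp (σ • v)) ∉ Ω := by
    simpa [segmentDomain, and_assoc] using hv
  let γ : Set.Icc (0 : ℝ) 1 → Heis n := fun τ => mul p (hexp (τ.1 • v))
  have hγ : Continuous γ := by fun_prop
  obtain ⟨τ, hτ⟩ : (frontier (γ ⁻¹' Ω)).Nonempty :=
    nonempty_frontier_iff.2 ⟨⟨0, by simpa [γ] using hp⟩,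
      (Set.ne_univ_iff_exists_notMem _).2 ⟨⟨σ, hσ⟩, hσΩ⟩⟩
  exact ⟨τ, τ.2, hγ.frontier_preimage_subset Ω hτ⟩

lemma mem_segmentDomain_of_lt_ccDist {p : Heis n} (hp : p ∈ Ω) {v : Hor n}
    (h : ∀ z ∈ frontier Ω, ENNReal.ofReal ‖v‖ < ccDist p z) : p ∈ segmentDomain Ω v := by
  by_contra hv
  obtain ⟨τ, hτ, hfr⟩ := exists_mul_hexp_mem_frontier hp hv
  refine (h _ hfr).not_ge ((ccDist_mul_hexp_le p (τ • v)).trans (ENNReal.ofReal_le_ofReal ?_))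
  rw [norm_smul, Real.norm_of_nonneg hτ.1]
  exact mul_le_of_le_one_left (norm_nonneg v) hτ.2

lemma mem_pathDomain_of_lt_ccDist {l : List (Hor n)} {p : Heis n} (hp : p ∈ Ω)
    (h : ∀ z ∈ frontier Ω, ENNReal.ofReal (pathLength l) < ccDist p z) : p ∈ pathDomain Ω l := by
  induction l generalizing p with
  | nil => exact hp
  | cons v l ih =>
    simp only [pathLength_cons, ENNReal.ofReal_add (norm_nonneg v) (pathLength_nonneg l)] at h
    have hseg : p ∈ segmentDomain Ω v :=
      mem_segmentDomain_of_lt_ccDist hp fun z hz => le_self_add.trans_lt (h z hz)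
    refine ⟨hseg, ih (mul_hexp_mem hseg) fun z hz => ?_⟩
    have hsum : ENNReal.ofReal ‖v‖ + ENNReal.ofReal (pathLength l) <
        ENNReal.ofReal ‖v‖ + ccDist (mul p (hexp v)) z :=
      (h z hz).trans_le ((ccDist_triangle p _ z).trans
        (by gcongr; exact ccDist_mul_hexp_le p v))
    exact lt_of_add_lt_add_left hsum

lemma subset_pathDomain_of_lt_ccSetDist {A : Set (Heis n)} (hAΩ : A ⊆ Ω) {l : List (Hor n)}
    (h : ENNReal.ofReal (pathLength l) < ccSetDist A (frontier Ω)) : A ⊆ pathDomain Ω l :=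
  fun p hp => mem_pathDomain_of_lt_ccDist (hAΩ hp) fun z hz =>
    h.trans_le ((iInf₂_le p hp).trans (iInf₂_le z hz))

lemma endpoint_commutator (a b : Hor n) : endpoint [a, b, -a, -b] = (0, 2 * symp a b) := by
  simp only [endpoint, hexp, mul_eq]
  ext1
  · simp
  · simp only [Prod.snd_zero, add_zero, map_neg, Prod.fst_zero, neg_apply, map_zero, neg_zero,
      neg_neg, zero_add, map_add, symp_swap a b, symp_self, add_neg_cancel_comm_assoc]
    ring

lemma exists_two_mul_symp_eq (hn : 1 ≤ n) (t : ℝ) :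
    ∃ a b : Hor n, 2 * symp a b = t ∧ ‖a‖ = √|t| / 2 ∧ ‖b‖ = √|t| / 2 := by
  let x : Hor n := EuclideanSpace.single (Sum.inl ⟨0, hn⟩) (√|t| / 2)
  let y : Hor n := EuclideanSpace.single (Sum.inr ⟨0, hn⟩) (√|t| / 2)
  have hx : ‖x‖ = √|t| / 2 := by simp [x]
  have hy : ‖y‖ = √|t| / 2 := by simp [y]
  have hxy : 2 * symp x y = -|t| := by
    rw [symp_single]
    linarith [Real.mul_self_sqrt (abs_nonneg t)]
  rcases le_total 0 t with ht | ht
  · exact ⟨y, x, by rw [symp_swap, mul_neg, hxy, neg_neg, abs_of_nonneg ht], hy, hx⟩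
  · exact ⟨x, y, by rw [hxy, abs_of_nonpos ht, neg_neg], hx, hy⟩

lemma exists_endpoint_eq (hn : 1 ≤ n) (w : Heis n) :
    ∃ l : List (Hor n), endpoint l = w ∧ pathLength l = ‖w.1‖ + 2 * √|w.2| := by
  obtain ⟨a, b, hab, ha, hb⟩ := exists_two_mul_symp_eq hn w.2
  refine ⟨[w.1, a, b, -a, -b], ?_, ?_⟩
  · rw [endpoint, endpoint_commutator, hab]
    simp [mul_eq, hexp]
  · simp only [pathLength_cons, pathLength_nil, norm_neg, ha, hb]
    ring

end Paths

section TestFunctions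

variable {Ω : Set (Heis n)} {φ : Heis n → ℝ} {v : Hor n}

lemma fderiv_comp_mul_horizontalField (hφ : Differentiable ℝ φ) {q : Heis n}
    (hq : symp q.1 v = 0) (p : Heis n) :
    fderiv ℝ (fun p => φ (mul p q)) p (horizontalField v p) =
      fderiv ℝ φ (mul p q) (horizontalField v (mul p q)) := by
  have hcomp : Differentiable ℝ fun p => φ (mul p q) :=
    hφ.comp ((contDiff_mul_right q).differentiable one_ne_zero)
  rw [← (hcomp p).lineDeriv_eq_fderiv, ← (hφ _).lineDeriv_eq_fderiv]
  simp only [lineDeriv, mul_add_smul_horizontalField hq]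

lemma hasDerivAt_comp_mul_neg_hexp_smul (hφ : Differentiable ℝ φ) (p : Heis n) (τ : ℝ) :
    HasDerivAt (fun τ : ℝ => φ (mul p (-hexp (τ • v))))
      (-fderiv ℝ φ (mul p (-hexp (τ • v))) (horizontalField v (mul p (-hexp (τ • v))))) τ := by
  have hfield : horizontalField v (mul p (-hexp (τ • v))) = horizontalField v p := by
    simp [mul_eq, hexp, horizontalField]
  rw [hfield, ← map_neg]
  simp only [mul_neg_hexp_smul]
  refine (hφ _).hasFDerivAt.comp_hasDerivAt τ ?_
  simpa only [one_smul] using ((hasDerivAt_id' τ).smul_const (horizontalField v p)).const_sub p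

lemma continuous_fderiv_horizontalField (hφ : ContDiff ℝ 1 φ) (v : Hor n) :
    Continuous fun p => fderiv ℝ φ p (horizontalField v p) :=
  (hφ.continuous_fderiv one_ne_zero).clm_apply (continuous_horizontalField v)

lemma tsupport_fderiv_horizontalField_subset (φ : Heis n → ℝ) (v : Hor n) :
    tsupport (fun p => fderiv ℝ φ p (horizontalField v p)) ⊆ tsupport φ :=
  closure_minimal (fun p hp => support_fderiv_subset ℝ fun h => hp (by simp [h]))
    (isClosed_tsupport φ)

lemma comp_mul_neg_hexp_sub_eq_integral (hφ : ContDiff ℝ 1 φ) (p : Heis n) :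
    φ (mul p (-hexp v)) - φ p = ∫ τ in Set.Icc (0 : ℝ) 1,
      -fderiv ℝ φ (mul p (-hexp (τ • v))) (horizontalField v (mul p (-hexp (τ • v)))) := by
  have hcont : Continuous fun τ : ℝ => mul p (-hexp (τ • v)) := by fun_prop
  rw [integral_Icc_eq_integral_Ioc, ← intervalIntegral.integral_of_le zero_le_one,
    intervalIntegral.integral_eq_sub_of_hasDerivAt
      (fun τ _ => hasDerivAt_comp_mul_neg_hexp_smul (hφ.differentiable one_ne_zero) p τ)
      (((continuous_fderiv_horizontalField hφ v).comp hcont).neg.intervalIntegrable _ _)]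
  simp

lemma tsupport_comp_mul_neg_hexp_subset (hφ : tsupport φ ⊆ segmentDomain Ω v) {τ : ℝ}
    (hτ : τ ∈ Set.Icc (0 : ℝ) 1) : tsupport (fun p => φ (mul p (-hexp (τ • v)))) ⊆ Ω := by
  intro p hp
  have hp' : mul p (-hexp (τ • v)) ∈ tsupport φ :=
    tsupport_comp_subset_preimage φ (rightMul (-hexp (τ • v))).continuous hp
  simpa using hφ hp' τ hτ

lemma hasCompactSupport_comp_mul (hφ : HasCompactSupport φ) (q : Heis n) :
    HasCompactSupport fun p => φ (mul p q) :=
  hφ.comp_homeomorph (rightMul q)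

lemma integral_comp_mul (g : Heis n → ℝ) (q : Heis n) : ∫ p, g (mul p q) = ∫ p, g p :=
  (measurePreserving_mul_right q).integral_comp (rightMul q).measurableEmbedding g

end TestFunctions

section WeakDerivative

variable {Ω : Set (Heis n)} {v : Hor n} {u g φ : Heis n → ℝ}

/-- On the open set `Ω`, the derivative of the distribution `u` along the left-invariant field
`∑ j, v j • Z j` is represented by the locally integrable function `g`. -/
def IsWeakHorizontalDeriv (Ω : Set (Heis n)) (v : Hor n) (u g : Heis n → ℝ) : Prop :=
  LocallyIntegrableOn u Ω volume ∧ LocallyIntegrableOn g Ω volume ∧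
    ∀ φ : Heis n → ℝ, ContDiff ℝ ((⊤ : ℕ∞) : WithTop ℕ∞) φ → HasCompactSupport φ →
      tsupport φ ⊆ Ω → ∫ p in Ω, g p * φ p = -∫ p in Ω, u p * fderiv ℝ φ p (horizontalField v p)

lemma IsWeakHorizontalDeriv.integral_mul_eq (h : IsWeakHorizontalDeriv Ω v u g)
    (hφ : ContDiff ℝ ((⊤ : ℕ∞) : WithTop ℕ∞) φ) (hφc : HasCompactSupport φ) (hφΩ : tsupport φ ⊆ Ω) :
    ∫ p, g p * φ p = ∫ p, u p * -fderiv ℝ φ p (horizontalField v p) := by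
  have hDΩ := (tsupport_fderiv_horizontalField_subset φ v).trans hφΩ
  simp only [mul_neg, integral_neg]
  rw [← setIntegral_mul_eq_integral hφΩ, ← setIntegral_mul_eq_integral hDΩ]
  exact h.2.2 φ hφ hφc hφΩ

lemma IsWeakHorizontalDeriv.integral_comp_mul_hexp_mul (h : IsWeakHorizontalDeriv Ω v u g)
    (hφ : ContDiff ℝ ((⊤ : ℕ∞) : WithTop ℕ∞) φ) (hφc : HasCompactSupport φ)
    (hφΩ : tsupport φ ⊆ segmentDomain Ω v) {τ : ℝ} (hτ : τ ∈ Set.Icc (0 : ℝ) 1) :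
    ∫ p, g (mul p (hexp (τ • v))) * φ p =
      ∫ p, u p * -fderiv ℝ φ (mul p (-hexp (τ • v)))
        (horizontalField v (mul p (-hexp (τ • v)))) := by
  have hq : symp (-hexp (τ • v)).1 v = 0 := by simp [hexp]
  have hφτ : ContDiff ℝ ((⊤ : ℕ∞) : WithTop ℕ∞) fun p => φ (mul p (-hexp (τ • v))) :=
    hφ.comp (contDiff_mul_right _)
  simp only [← fderiv_comp_mul_horizontalField (hφ.differentiable (by simp)) hq]
  rw [← h.integral_mul_eq hφτ (hasCompactSupport_comp_mul hφc _)
      (tsupport_comp_mul_neg_hexp_subset hφΩ hτ),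
    ← integral_comp_mul (fun p => g p * φ (mul p (-hexp (τ • v)))) (hexp (τ • v))]
  simp only [Heisenberg.mul_neg_cancel_right]

lemma integral_comp_mul_hexp_sub_mul (hu : LocallyIntegrableOn u Ω volume) (hφ : Continuous φ)
    (hφc : HasCompactSupport φ) (hφΩ : tsupport φ ⊆ segmentDomain Ω v) :
    ∫ p, (u (mul p (hexp v)) - u p) * φ p = ∫ p, u p * (φ (mul p (-hexp v)) - φ p) := by
  have hφv : Integrable fun p => u p * φ (mul p (-hexp v)) :=
    integrable_mul_of_tsupport_subset hu (by fun_prop) (hasCompactSupport_comp_mul hφc _)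
      (by simpa using tsupport_comp_mul_neg_hexp_subset hφΩ (τ := 1) (by simp))
  have hφ0 : Integrable fun p => u p * φ p :=
    integrable_mul_of_tsupport_subset hu hφ hφc (hφΩ.trans (segmentDomain_subset v))
  have huv : Integrable fun p => u (mul p (hexp v)) * φ p := by
    simpa [Function.comp_def] using
      (measurePreserving_mul_right (hexp v)).integrable_comp_of_integrable hφv
  simp only [sub_mul, mul_sub]
  rw [integral_sub huv hφ0, integral_sub hφv hφ0,
    ← integral_comp_mul (fun p => u p * φ (mul p (-hexp v))) (hexp v)]
  simp only [Heisenberg.mul_neg_cancel_right]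

lemma integrable_mul_comp_mul_neg_hexp (hg : LocallyIntegrableOn g Ω volume) (hφ : Continuous φ)
    (hφc : HasCompactSupport φ) (hφΩ : tsupport φ ⊆ segmentDomain Ω v) :
    Integrable (fun z : Heis n × ℝ => g z.1 * φ (mul z.1 (-hexp (z.2 • v))))
      (volume.prod (volume.restrict (Set.Icc 0 1))) := by
  let K : Set (Heis n) :=
    (fun z : Heis n × ℝ => mul z.1 (hexp (z.2 • v))) '' (tsupport φ ×ˢ Set.Icc 0 1)
  have hK : IsCompact K := (hφc.prod isCompact_Icc).image (by fun_prop)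
  have hKΩ : K ⊆ Ω := by
    rintro _ ⟨⟨p, τ⟩, ⟨hp, hτ⟩, rfl⟩
    exact hφΩ hp τ hτ
  have hgK : Integrable (K.indicator g) volume :=
    (integrable_indicator_iff hK.measurableSet).2 (hg.integrableOn_compact_subset hKΩ hK)
  obtain ⟨C, hC⟩ := hφ.bounded_above_of_compact_support hφc
  have hprod := (hgK.comp_fst (volume.restrict (Set.Icc (0 : ℝ) 1))).mul_bdd
    (g := fun z => φ (mul z.1 (-hexp (z.2 • v))))
    (Continuous.aestronglyMeasurable (by fun_prop)) (ae_of_all _ fun z => hC _)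
  refine hprod.congr ?_
  filter_upwards [Measure.quasiMeasurePreserving_snd.ae (ae_restrict_mem measurableSet_Icc)]
    with z hz
  by_cases hzK : z.1 ∈ K
  · rw [Set.indicator_of_mem hzK]
  · have hφz : φ (mul z.1 (-hexp (z.2 • v))) = 0 := by
      by_contra hne
      exact hzK ⟨(_, z.2), ⟨subset_tsupport _ hne, hz⟩, Heisenberg.mul_neg_mul_cancel _ _⟩
    rw [hφz, mul_zero, mul_zero]

lemma measurePreserving_shear (v : Hor n) (ν : Measure ℝ) [SFinite ν] :
    MeasurePreserving (fun z : Heis n × ℝ => (mul z.1 (hexp (z.2 • v)), z.2))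
      (volume.prod ν) (volume.prod ν) :=
  Measure.measurePreserving_swap.comp ((MeasurePreserving.skew_product
    (g := fun (τ : ℝ) p => mul p (hexp (τ • v))) (MeasurePreserving.id ν)
    (Continuous.measurable (by unfold Function.uncurry; fun_prop))
    (ae_of_all _ fun τ => (measurePreserving_mul_right _).map_eq)).comp
    Measure.measurePreserving_swap)

lemma integrable_comp_mul_hexp_mul (hg : LocallyIntegrableOn g Ω volume) (hφ : Continuous φ)
    (hφc : HasCompactSupport φ) (hφΩ : tsupport φ ⊆ segmentDomain Ω v) :
    Integrable (fun z : Heis n × ℝ => g (mul z.1 (hexp (z.2 • v))) * φ z.1)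
      (volume.prod (volume.restrict (Set.Icc 0 1))) := by
  simpa [Function.comp_def] using
    (measurePreserving_shear v (volume.restrict (Set.Icc 0 1))).integrable_comp_of_integrable
      (integrable_mul_comp_mul_neg_hexp hg hφ hφc hφΩ)

lemma IsWeakHorizontalDeriv.integral_sub_mul_eq (h : IsWeakHorizontalDeriv Ω v u g)
    (hφ : ContDiff ℝ ((⊤ : ℕ∞) : WithTop ℕ∞) φ) (hφc : HasCompactSupport φ)
    (hφΩ : tsupport φ ⊆ segmentDomain Ω v) :
    ∫ p, (u (mul p (hexp v)) - u p) * φ p =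
      ∫ p, (∫ τ in Set.Icc (0 : ℝ) 1, g (mul p (hexp (τ • v)))) * φ p := by
  have hφ1 : ContDiff ℝ 1 φ := hφ.of_le (by exact_mod_cast le_top)
  let D : Heis n → ℝ := fun p => -fderiv ℝ φ p (horizontalField v p)
  have hDφ : tsupport D ⊆ tsupport φ := by
    simpa only [D, tsupport_fun_neg] using tsupport_fderiv_horizontalField_subset φ v
  have huD := integrable_mul_comp_mul_neg_hexp h.1 (φ := D)
    (continuous_fderiv_horizontalField hφ1 v).neg (hφc.of_isClosed_subset (isClosed_tsupport _) hDφ)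
    (hDφ.trans hφΩ)
  calc ∫ p, (u (mul p (hexp v)) - u p) * φ p
      = ∫ p, u p * (φ (mul p (-hexp v)) - φ p) :=
        integral_comp_mul_hexp_sub_mul h.1 hφ.continuous hφc hφΩ
    _ = ∫ p, ∫ τ in Set.Icc (0 : ℝ) 1, u p * D (mul p (-hexp (τ • v))) := by
        simp only [comp_mul_neg_hexp_sub_eq_integral hφ1, ← integral_const_mul, D]
    _ = ∫ τ in Set.Icc (0 : ℝ) 1, ∫ p, u p * D (mul p (-hexp (τ • v))) :=
        integral_integral_swap huD
    _ = ∫ τ in Set.Icc (0 : ℝ) 1, ∫ p, g (mul p (hexp (τ • v))) * φ p :=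
        setIntegral_congr_fun measurableSet_Icc fun τ hτ =>
          (h.integral_comp_mul_hexp_mul hφ hφc hφΩ hτ).symm
    _ = ∫ p, ∫ τ in Set.Icc (0 : ℝ) 1, g (mul p (hexp (τ • v))) * φ p :=
        (integral_integral_swap
          (integrable_comp_mul_hexp_mul h.2.1 hφ.continuous hφc hφΩ)).symm
    _ = ∫ p, (∫ τ in Set.Icc (0 : ℝ) 1, g (mul p (hexp (τ • v)))) * φ p := by
        simp only [integral_mul_const]

lemma locallyIntegrableOn_comp_mul_hexp (hΩ : IsOpen Ω) (hu : LocallyIntegrableOn u Ω volume) :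
    LocallyIntegrableOn (fun p => u (mul p (hexp v))) (segmentDomain Ω v) volume := by
  refine locallyIntegrableOn_of_integrable_mul (isOpen_segmentDomain hΩ v) fun φ hφ hφc hφΩ => ?_
  have hint : Integrable fun p => u p * φ (mul p (-hexp v)) :=
    integrable_mul_of_tsupport_subset hu (by fun_prop) (hasCompactSupport_comp_mul hφc _)
      (by simpa using tsupport_comp_mul_neg_hexp_subset hφΩ (τ := 1) (by simp))
  simpa [Function.comp_def] using
    (measurePreserving_mul_right (hexp v)).integrable_comp_of_integrable hint

lemma locallyIntegrableOn_integral_comp_mul_hexp (hΩ : IsOpen Ω)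
    (hg : LocallyIntegrableOn g Ω volume) :
    LocallyIntegrableOn (fun p => ∫ τ in Set.Icc (0 : ℝ) 1, g (mul p (hexp (τ • v))))
      (segmentDomain Ω v) volume := by
  refine locallyIntegrableOn_of_integrable_mul (isOpen_segmentDomain hΩ v) fun φ hφ hφc hφΩ => ?_
  simpa only [integral_mul_const] using
    (integrable_comp_mul_hexp_mul hg hφ hφc hφΩ).integral_prod_left

lemma IsWeakHorizontalDeriv.ae_sub_eq_integral (hΩ : IsOpen Ω)
    (h : IsWeakHorizontalDeriv Ω v u g) :
    ∀ᵐ p ∂volume.restrict (segmentDomain Ω v), u (mul p (hexp v)) - u p =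
      ∫ τ in Set.Icc (0 : ℝ) 1, g (mul p (hexp (τ • v))) := by
  have hU : IsOpen (segmentDomain Ω v) := isOpen_segmentDomain hΩ v
  exact ae_eq_restrict_of_integral_mul_eq hU
    ((locallyIntegrableOn_comp_mul_hexp hΩ h.1).sub (h.1.mono_set (segmentDomain_subset v)))
    (locallyIntegrableOn_integral_comp_mul_hexp hΩ h.2.1) fun φ hφ hφc hφU =>
      h.integral_sub_mul_eq hφ hφc hφU

end WeakDerivative

section Gradient

variable {Ω : Set (Heis n)} {u : Heis n → ℝ} {G : Heis n → Hor n} {s : ℝ≥0∞}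

lemma IsWeakZDeriv.ae_eq {j : Fin n ⊕ Fin n} {g g' : Heis n → ℝ} (hΩ : IsOpen Ω)
    (h : IsWeakZDeriv Ω j u g) (h' : IsWeakZDeriv Ω j u g') : g =ᵐ[volume.restrict Ω] g' :=
  ae_eq_restrict_of_integral_mul_eq hΩ h.2.1 h'.2.1 fun φ hφ hφc hφΩ => by
    rw [← setIntegral_mul_eq_integral (g := g) hφΩ, ← setIntegral_mul_eq_integral (g := g') hφΩ,
      h.2.2 φ hφ hφc hφΩ, h'.2.2 φ hφ hφc hφΩ]

lemma MemHorizontalSobolev.memLp_gradient (hΩ : IsOpen Ω) (hu : MemHorizontalSobolev s Ω u)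
    (hG : IsWeakHorizontalGradient Ω u G) : MemLp G s (volume.restrict Ω) := by
  refine MemLp.of_eval_piLp fun j => ?_
  obtain ⟨g, hg, hgu⟩ := hu.2 j
  exact hg.ae_eq (hgu.ae_eq hΩ (hG j))

lemma Z_eq_horizontalField (j : Fin n ⊕ Fin n) (p : Heis n) :
    Z j p = horizontalField (EuclideanSpace.single j 1) p := by
  simp [← sum_smul_Z, -Fintype.sum_sum_type]

lemma integrable_mul_ZDeriv (hu : LocallyIntegrableOn u Ω volume) {φ : Heis n → ℝ}
    (hφ : ContDiff ℝ 1 φ) (hφc : HasCompactSupport φ) (hφΩ : tsupport φ ⊆ Ω)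
    (j : Fin n ⊕ Fin n) : Integrable fun p => u p * ZDeriv j φ p := by
  simp only [ZDeriv, Z_eq_horizontalField]
  have hsupp := tsupport_fderiv_horizontalField_subset φ (EuclideanSpace.single j 1)
  exact integrable_mul_of_tsupport_subset hu (continuous_fderiv_horizontalField hφ _)
    (hφc.of_isClosed_subset (isClosed_tsupport _) hsupp) (hsupp.trans hφΩ)

lemma IsWeakHorizontalGradient.isWeakHorizontalDeriv (hΩ : IsOpen Ω)
    (hu : LocallyIntegrableOn u Ω volume) (hG : IsWeakHorizontalGradient Ω u G) (v : Hor n) :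
    IsWeakHorizontalDeriv Ω v u fun p => inner ℝ (G p) v := by
  have hexpand : ∀ (φ : Heis n → ℝ) (p : Heis n),
      inner ℝ (G p) v * φ p = ∑ j, v j * (G p j * φ p) := fun φ p => by
    simp [PiLp.inner_apply, Finset.sum_mul, mul_assoc, -Fintype.sum_sum_type]
  have hGφ : ∀ φ : Heis n → ℝ, Continuous φ → HasCompactSupport φ → tsupport φ ⊆ Ω →
      ∀ j, Integrable fun p => v j * (G p j * φ p) := fun φ hφ hφc hφΩ j =>
    (integrable_mul_of_tsupport_subset (hG j).2.1 hφ hφc hφΩ).const_mul (v j)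
  refine ⟨hu, locallyIntegrableOn_of_integrable_mul hΩ fun φ hφ hφc hφΩ => ?_,
    fun φ hφ hφc hφΩ => ?_⟩
  · simpa only [hexpand] using integrable_finsetSum _ fun j _ => hGφ φ hφ hφc hφΩ j
  have huφ : ∀ j, Integrable fun p => v j * (u p * ZDeriv j φ p) := fun j =>
    (integrable_mul_ZDeriv hu (hφ.of_le (by exact_mod_cast le_top)) hφc hφΩ j).const_mul (v j)
  calc ∫ p in Ω, inner ℝ (G p) v * φ p
      = ∑ j, v j * ∫ p in Ω, G p j * φ p := by
        simp only [hexpand, ← integral_const_mul]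
        exact integral_finsetSum _ fun j _ => (hGφ φ hφ.continuous hφc hφΩ j).integrableOn
    _ = -∑ j, v j * ∫ p in Ω, u p * ZDeriv j φ p := by
        simp only [(hG _).2.2 φ hφ hφc hφΩ, mul_neg, Finset.sum_neg_distrib]
    _ = -∫ p in Ω, ∑ j, v j * (u p * ZDeriv j φ p) := by
        simp only [← integral_const_mul]
        rw [integral_finsetSum _ fun j _ => (huφ j).integrableOn]
    _ = -∫ p in Ω, u p * fderiv ℝ φ p (horizontalField v p) := by
        simp only [← sum_smul_Z, map_sum, map_smul, smul_eq_mul, Finset.mul_sum, ZDeriv,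
          mul_left_comm]

end Gradient

section Segments

variable {Ω : Set (Heis n)} {v : Hor n} {u g : Heis n → ℝ} {s : ℝ≥0∞} {C : ℝ≥0∞}

instance isProbabilityMeasure_restrict_Icc_zero_one :
    IsProbabilityMeasure (volume.restrict (Set.Icc (0 : ℝ) 1)) :=
  ⟨by simp⟩

lemma aestronglyMeasurable_comp_mul_hexp
    (hg : AEStronglyMeasurable g (volume.restrict Ω)) :
    AEStronglyMeasurable (fun z : Heis n × ℝ => g (mul z.1 (hexp (z.2 • v))))
      ((volume.restrict (segmentDomain Ω v)).prod (volume.restrict (Set.Icc 0 1))) := by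
  have hmaps : Set.MapsTo (fun z : Heis n × ℝ => (mul z.1 (hexp (z.2 • v)), z.2))
      (segmentDomain Ω v ×ˢ Set.Icc 0 1) (Ω ×ˢ Set.Icc 0 1) :=
    fun z hz => ⟨hz.1 z.2 hz.2, hz.2⟩
  have hshear := (measurePreserving_shear v volume).quasiMeasurePreserving.restrict hmaps
  rw [← Measure.prod_restrict, ← Measure.prod_restrict] at hshear
  exact hg.comp_fst.comp_quasiMeasurePreserving hshear

lemma ae_integrable_comp_mul_hexp (hΩ : IsOpen Ω) (hg : LocallyIntegrableOn g Ω volume) :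
    ∀ᵐ p ∂volume.restrict (segmentDomain Ω v),
      Integrable (fun τ => g (mul p (hexp (τ • v)))) (volume.restrict (Set.Icc (0 : ℝ) 1)) := by
  have hU : IsOpen (segmentDomain Ω v) := isOpen_segmentDomain hΩ v
  rw [ae_restrict_iff' hU.measurableSet]
  refine measure_null_of_locally_null _ fun x hx => ?_
  rw [Set.mem_compl_iff, Set.mem_ofPred_eq, Classical.not_imp] at hx
  obtain ⟨φ, hφx, hφc, hφU, -⟩ :=
    exists_continuousMap_one_of_isCompact_subset_isOpen isCompact_singleton hU
      (Set.singleton_subset_iff.2 hx.1)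
  have hφ0 : ∀ᶠ p in 𝓝 x, φ p ≠ 0 :=
    φ.continuous.continuousAt.eventually_ne (by simp [hφx rfl])
  have hint := (integrable_comp_mul_hexp_mul hg φ.continuous hφc hφU).prod_right_ae
  refine ⟨_, inter_mem_nhdsWithin _ hφ0, measure_mono_null ?_ hint⟩
  rintro p ⟨hpP, hp0⟩ hp
  exact hpP fun _ => (integrable_mul_const_iff (isUnit_iff_ne_zero.2 hp0) _).1 hp

lemma IsWeakHorizontalDeriv.eLpNorm_sub_le (hs : 1 ≤ s) (hΩ : IsOpen Ω)
    (h : IsWeakHorizontalDeriv Ω v u g) :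
    eLpNorm (fun p => u (mul p (hexp v)) - u p) s (volume.restrict (segmentDomain Ω v)) ≤
      eLpNorm g s (volume.restrict Ω) := by
  rw [eLpNorm_congr_ae (h.ae_sub_eq_integral hΩ)]
  refine eLpNorm_integral_le_of_ae_le hs (H := fun z : Heis n × ℝ => g (mul z.1 (hexp (z.2 • v))))
    (aestronglyMeasurable_comp_mul_hexp h.2.1.aestronglyMeasurable) ?_
  filter_upwards [ae_restrict_mem measurableSet_Icc] with τ hτ
  exact eLpNorm_comp_mul_right_restrict_le fun p hp => hp τ hτ

lemma IsWeakHorizontalDeriv.eLpNorm_sub_sub_le (hs : 1 ≤ s) (hΩ : IsOpen Ω)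
    (h : IsWeakHorizontalDeriv Ω v u g)
    (hC : ∀ τ ∈ Set.Icc (0 : ℝ) 1, eLpNorm (fun p => g (mul p (hexp (τ • v))) - g p) s
      (volume.restrict (segmentDomain Ω v)) ≤ C) :
    eLpNorm (fun p => u (mul p (hexp v)) - u p - g p) s
      (volume.restrict (segmentDomain Ω v)) ≤ C := by
  have hgm := h.2.1.aestronglyMeasurable
  have hrem : (fun p => u (mul p (hexp v)) - u p - g p)
      =ᵐ[volume.restrict (segmentDomain Ω v)]
        fun p => ∫ τ in Set.Icc (0 : ℝ) 1, (g (mul p (hexp (τ • v))) - g p) := by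
    filter_upwards [h.ae_sub_eq_integral hΩ, ae_integrable_comp_mul_hexp hΩ h.2.1] with p hp hint
    rw [hp, integral_sub hint (integrable_const _)]
    simp
  rw [eLpNorm_congr_ae hrem]
  refine eLpNorm_integral_le_of_ae_le hs
    (H := fun z : Heis n × ℝ => g (mul z.1 (hexp (z.2 • v))) - g z.1)
    ((aestronglyMeasurable_comp_mul_hexp hgm).sub
      (hgm.mono_set (segmentDomain_subset v)).comp_fst) ?_
  filter_upwards [ae_restrict_mem measurableSet_Icc] with τ hτ
  exact hC τ hτ

end Segments

section TranslationContinuity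

variable {E : Type*} [NormedAddCommGroup E] {Ω : Set (Heis n)} {g : Heis n → E} {s : ℝ≥0∞}

lemma eventually_forall_eLpNorm_comp_mul_hexp_sub_le (hs : 1 ≤ s) (hs' : s ≠ ∞) (hΩ : IsOpen Ω)
    (hg : MemLp g s (volume.restrict Ω)) (v : Hor n) {η : ℝ≥0∞} (hη : 0 < η) :
    ∀ᶠ ε : ℝ in 𝓝 0, ∀ τ ∈ Set.Icc (0 : ℝ) 1,
      eLpNorm (fun p => g (mul p (hexp (τ • ε • v))) - g p) s
        (volume.restrict (segmentDomain Ω (ε • v))) ≤ η := by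
  have hind := tendsto_eLpNorm_mul_right_sub hs hs' (g := Ω.indicator g)
    ((memLp_indicator_iff_restrict hΩ.measurableSet).2 hg)
  have hsmall : ∀ᶠ ε : ℝ in 𝓝 0, ∀ τ ∈ Set.Icc (0 : ℝ) 1,
      eLpNorm (fun p => Ω.indicator g (mul p (hexp (τ • ε • v))) - Ω.indicator g p) s volume
        ≤ η := by
    refine isCompact_Icc.eventually_forall_of_forall_eventually fun τ _ => ?_
    have hcont : Continuous fun z : ℝ × ℝ => hexp (z.2 • z.1 • v) := by fun_prop
    have hlim : Tendsto (fun z : ℝ × ℝ => hexp (z.2 • z.1 • v)) (𝓝 (0, τ)) (𝓝 0) := by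
      simpa using hcont.tendsto (0, τ)
    exact (hind.comp hlim).eventually_le_const hη
  filter_upwards [hsmall] with ε hε τ hτ
  refine le_trans (le_of_eq (eLpNorm_congr_ae ?_))
    ((eLpNorm_mono_measure _ Measure.restrict_le_self).trans (hε τ hτ))
  filter_upwards [ae_restrict_mem (isOpen_segmentDomain hΩ (ε • v)).measurableSet] with p hp
  rw [Set.indicator_of_mem (hp τ hτ), Set.indicator_of_mem (segmentDomain_subset _ hp)]

end TranslationContinuity

section DifferenceQuotients

variable {Ω : Set (Heis n)} {u : Heis n → ℝ} {G : Heis n → Hor n} {s : ℝ≥0∞} {ε : ℝ}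

lemma eLpNorm_inner_const_le {X F : Type*} [MeasurableSpace X] [NormedAddCommGroup F]
    [InnerProductSpace ℝ F] (μ : Measure X) (G : X → F) (v : F) :
    eLpNorm (fun x => inner ℝ (G x) v) s μ ≤ ENNReal.ofReal ‖v‖ * eLpNorm G s μ :=
  eLpNorm_le_mul_eLpNorm_of_ae_le_mul
    (ae_of_all _ fun _ => (norm_inner_le_norm _ _).trans_eq (mul_comm _ _)) s

lemma diffQuot_mul_hexp (u : Heis n → ℝ) (v : Hor n) (q : Heis n) (ε : ℝ) (p : Heis n) :
    diffQuot u (mul (hexp v) q) ε p =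
      diffQuot u q ε (mul p (hexp (ε • v))) + diffQuot u (hexp v) ε p := by
  simp only [diffQuot, dil_mul, dil_hexp, Heisenberg.mul_assoc]
  ring

lemma diffQuot_zero (u : Heis n → ℝ) (ε : ℝ) : diffQuot u 0 ε = 0 := by
  ext p
  simp [diffQuot, dil, show ((0 : Hor n), (0 : ℝ)) = 0 from rfl]

lemma mapsTo_mul_dil_endpoint (ε : ℝ) (l : List (Hor n)) :
    Set.MapsTo (fun p => mul p (dil ε (endpoint l))) (pathDomain Ω (l.map (ε • ·))) Ω :=
  fun _ hp => endpoint_map_smul ε l ▸ mul_endpoint_mem hp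

lemma aestronglyMeasurable_comp_mul {F : Type*} [TopologicalSpace F] {g : Heis n → F}
    (hg : AEStronglyMeasurable g (volume.restrict Ω)) {q : Heis n} {S : Set (Heis n)}
    (hS : Set.MapsTo (fun p => mul p q) S Ω) :
    AEStronglyMeasurable (fun p => g (mul p q)) (volume.restrict S) :=
  hg.comp_quasiMeasurePreserving
    ((measurePreserving_mul_right q).quasiMeasurePreserving.restrict hS)

lemma aestronglyMeasurable_diffQuot (hu : AEStronglyMeasurable u (volume.restrict Ω))
    {w : Heis n} {S : Set (Heis n)} (hSΩ : S ⊆ Ω)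
    (hS : Set.MapsTo (fun p => mul p (dil ε w)) S Ω) :
    AEStronglyMeasurable (diffQuot u w ε) (volume.restrict S) := by
  unfold diffQuot
  simp only [div_eq_mul_inv]
  exact ((aestronglyMeasurable_comp_mul hu hS).sub (hu.mono_set hSΩ)).mul_const _

lemma eLpNorm_diffQuot_hexp_le (hs : 1 ≤ s) (hΩ : IsOpen Ω) (hu : LocallyIntegrableOn u Ω volume)
    (hG : IsWeakHorizontalGradient Ω u G) (hε : 0 < ε) (v : Hor n) :
    eLpNorm (diffQuot u (hexp v) ε) s (volume.restrict (segmentDomain Ω (ε • v))) ≤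
      ENNReal.ofReal ‖v‖ * eLpNorm G s (volume.restrict Ω) := by
  have hquot : diffQuot u (hexp v) ε = ε⁻¹ • fun p => u (mul p (hexp (ε • v))) - u p := by
    ext p
    simp [diffQuot, dil_hexp, div_eq_inv_mul]
  have hinner : (fun p => inner ℝ (G p) (ε • v)) = ε • fun p => inner ℝ (G p) v := by
    ext p
    simp [real_inner_smul_right]
  have hseg := (hG.isWeakHorizontalDeriv hΩ hu (ε • v)).eLpNorm_sub_le hs hΩ
  rw [hinner, eLpNorm_const_smul] at hseg
  calc eLpNorm (diffQuot u (hexp v) ε) s (volume.restrict (segmentDomain Ω (ε • v)))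
      ≤ ‖ε⁻¹‖ₑ * (‖ε‖ₑ * eLpNorm (fun p => inner ℝ (G p) v) s (volume.restrict Ω)) := by
        rw [hquot, eLpNorm_const_smul]
        gcongr
    _ = eLpNorm (fun p => inner ℝ (G p) v) s (volume.restrict Ω) := by
        rw [← mul_assoc, ← enorm_mul, inv_mul_cancel₀ hε.ne', enorm_one, one_mul]
    _ ≤ ENNReal.ofReal ‖v‖ * eLpNorm G s (volume.restrict Ω) := eLpNorm_inner_const_le _ G v

lemma eLpNorm_diffQuot_endpoint_le (hs : 1 ≤ s) (hΩ : IsOpen Ω)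
    (hu : LocallyIntegrableOn u Ω volume) (hG : IsWeakHorizontalGradient Ω u G) (hε : 0 < ε)
    (l : List (Hor n)) :
    eLpNorm (diffQuot u (endpoint l) ε) s (volume.restrict (pathDomain Ω (l.map (ε • ·)))) ≤
      ENNReal.ofReal (pathLength l) * eLpNorm G s (volume.restrict Ω) := by
  induction l with
  | nil => simp [endpoint, diffQuot_zero]
  | cons v l ih =>
    set S := pathDomain Ω ((v :: l).map (ε • ·))
    have hSv : S ⊆ segmentDomain Ω (ε • v) := Set.inter_subset_left
    have hSl : Set.MapsTo (fun p => mul p (hexp (ε • v))) S (pathDomain Ω (l.map (ε • ·))) :=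
      fun p hp => hp.2
    have hm := hu.aestronglyMeasurable
    have hquot := aestronglyMeasurable_diffQuot hm (pathDomain_subset _)
      (mapsTo_mul_dil_endpoint (Ω := Ω) ε l)
    calc eLpNorm (diffQuot u (endpoint (v :: l)) ε) s (volume.restrict S)
        = eLpNorm (fun p => diffQuot u (endpoint l) ε (mul p (hexp (ε • v))) +
            diffQuot u (hexp v) ε p) s (volume.restrict S) := by
          simp only [endpoint, ← diffQuot_mul_hexp]
      _ ≤ _ := eLpNorm_add_le (aestronglyMeasurable_comp_mul hquot hSl)
          (aestronglyMeasurable_diffQuot hm (pathDomain_subset _) fun p hp => by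
            simpa only [dil_hexp] using mul_hexp_mem (hSv hp)) hs
      _ ≤ ENNReal.ofReal (pathLength l) * eLpNorm G s (volume.restrict Ω) +
            ENNReal.ofReal ‖v‖ * eLpNorm G s (volume.restrict Ω) :=
          add_le_add ((eLpNorm_comp_mul_right_restrict_le hSl).trans ih)
            ((eLpNorm_mono_measure _ (Measure.restrict_mono hSv le_rfl)).trans
              (eLpNorm_diffQuot_hexp_le hs hΩ hu hG hε v))
      _ = ENNReal.ofReal (pathLength (v :: l)) * eLpNorm G s (volume.restrict Ω) := by
          rw [← add_mul, add_comm, pathLength_cons,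
            ENNReal.ofReal_add (norm_nonneg v) (pathLength_nonneg l)]

lemma tendsto_eLpNorm_diffQuot_hexp_sub_inner (hs : 1 ≤ s) (hs' : s ≠ ∞) (hΩ : IsOpen Ω)
    (hu : LocallyIntegrableOn u Ω volume) (hG : IsWeakHorizontalGradient Ω u G)
    (hGs : MemLp G s (volume.restrict Ω)) (v : Hor n) :
    Tendsto (fun ε : ℝ => eLpNorm (fun p => diffQuot u (hexp v) ε p - inner ℝ (G p) v) s
      (volume.restrict (segmentDomain Ω (ε • v)))) (𝓝[>] 0) (𝓝 0) := by
  refine ENNReal.tendsto_nhds_zero.2 fun η hη => ?_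
  have hmod := eventually_forall_eLpNorm_comp_mul_hexp_sub_le hs hs' hΩ
    (hGs.inner_const (𝕜 := ℝ) v) v hη
  filter_upwards [hmod.filter_mono nhdsWithin_le_nhds, self_mem_nhdsWithin] with ε hmod hε
  have hε' : ε ≠ 0 := (Set.mem_Ioi.1 hε).ne'
  have hrem : (fun p => diffQuot u (hexp v) ε p - inner ℝ (G p) v) =
      ε⁻¹ • fun p => u (mul p (hexp (ε • v))) - u p - inner ℝ (G p) (ε • v) := by
    ext p
    simp only [diffQuot, dil_hexp, real_inner_smul_right, Pi.smul_apply, smul_eq_mul]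
    field_simp
  have hseg := (hG.isWeakHorizontalDeriv hΩ hu (ε • v)).eLpNorm_sub_sub_le hs hΩ
    (C := ‖ε‖ₑ * η) fun τ hτ => by
      simp only [real_inner_smul_right, ← mul_sub]
      refine (eLpNorm_const_smul ε _ s _).le.trans ?_
      gcongr
      exact hmod τ hτ
  calc eLpNorm (fun p => diffQuot u (hexp v) ε p - inner ℝ (G p) v) s
        (volume.restrict (segmentDomain Ω (ε • v)))
      ≤ ‖ε⁻¹‖ₑ * (‖ε‖ₑ * η) := by
        rw [hrem, eLpNorm_const_smul]
        gcongr
    _ = η := by rw [← mul_assoc, ← enorm_mul, inv_mul_cancel₀ hε', enorm_one, one_mul]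

lemma diffQuot_endpoint_cons_sub_inner (v : Hor n) (l : List (Hor n)) (ε : ℝ) (p : Heis n) :
    diffQuot u (endpoint (v :: l)) ε p - inner ℝ (G p) (endpoint (v :: l)).1 =
      (diffQuot u (endpoint l) ε (mul p (hexp (ε • v))) -
          inner ℝ (G (mul p (hexp (ε • v)))) (endpoint l).1) +
        (inner ℝ (G (mul p (hexp (ε • v)))) (endpoint l).1 - inner ℝ (G p) (endpoint l).1) +
        (diffQuot u (hexp v) ε p - inner ℝ (G p) v) := by
  have hfst : (endpoint (v :: l)).1 = v + (endpoint l).1 := rfl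
  rw [hfst, inner_add_right, endpoint, diffQuot_mul_hexp]
  ring

lemma eLpNorm_diffQuot_endpoint_cons_sub_inner_le (hs : 1 ≤ s)
    (hu : AEStronglyMeasurable u (volume.restrict Ω))
    (hG : AEStronglyMeasurable G (volume.restrict Ω)) (v : Hor n) (l : List (Hor n)) (ε : ℝ) :
    eLpNorm (fun p => diffQuot u (endpoint (v :: l)) ε p - inner ℝ (G p) (endpoint (v :: l)).1) s
        (volume.restrict (pathDomain Ω ((v :: l).map (ε • ·)))) ≤
      eLpNorm (fun p => diffQuot u (endpoint l) ε p - inner ℝ (G p) (endpoint l).1) s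
          (volume.restrict (pathDomain Ω (l.map (ε • ·)))) +
        eLpNorm (fun p => inner ℝ (G (mul p (hexp (ε • v)))) (endpoint l).1 -
          inner ℝ (G p) (endpoint l).1) s (volume.restrict (segmentDomain Ω (ε • v))) +
        eLpNorm (fun p => diffQuot u (hexp v) ε p - inner ℝ (G p) v) s
          (volume.restrict (segmentDomain Ω (ε • v))) := by
  set S := pathDomain Ω ((v :: l).map (ε • ·))
  have hSΩ : S ⊆ Ω := pathDomain_subset _
  have hSv : S ⊆ segmentDomain Ω (ε • v) := Set.inter_subset_left
  have hSl : Set.MapsTo (fun p => mul p (hexp (ε • v))) S (pathDomain Ω (l.map (ε • ·))) :=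
    fun p hp => hp.2
  have hinner (w : Hor n) : AEStronglyMeasurable (fun p => inner ℝ (G p) w) (volume.restrict Ω) :=
    hG.inner aestronglyMeasurable_const
  have htail := aestronglyMeasurable_comp_mul
    ((aestronglyMeasurable_diffQuot hu (pathDomain_subset _) (mapsTo_mul_dil_endpoint ε l)).sub
      ((hinner (endpoint l).1).mono_set (pathDomain_subset _))) hSl
  have hshift := (aestronglyMeasurable_comp_mul (hinner (endpoint l).1)
    (hSl.mono_right (pathDomain_subset _))).sub ((hinner (endpoint l).1).mono_set hSΩ)
  have hhead := (aestronglyMeasurable_diffQuot (ε := ε) (w := hexp v) hu hSΩ fun p hp => by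
    simpa only [dil_hexp] using mul_hexp_mem (hSv hp)).sub ((hinner v).mono_set hSΩ)
  simp only [diffQuot_endpoint_cons_sub_inner]
  refine (eLpNorm_add_le (htail.add hshift) hhead hs).trans
    (add_le_add ((eLpNorm_add_le htail hshift hs).trans (add_le_add ?_ ?_)) ?_)
  · exact eLpNorm_comp_mul_right_restrict_le hSl
  · exact eLpNorm_mono_measure _ (Measure.restrict_mono hSv le_rfl)
  · exact eLpNorm_mono_measure _ (Measure.restrict_mono hSv le_rfl)

lemma tendsto_eLpNorm_diffQuot_endpoint_sub_inner (hs : 1 ≤ s) (hs' : s ≠ ∞) (hΩ : IsOpen Ω)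
    (hu : LocallyIntegrableOn u Ω volume) (hG : IsWeakHorizontalGradient Ω u G)
    (hGs : MemLp G s (volume.restrict Ω)) (l : List (Hor n)) :
    Tendsto (fun ε : ℝ => eLpNorm
      (fun p => diffQuot u (endpoint l) ε p - inner ℝ (G p) (endpoint l).1) s
      (volume.restrict (pathDomain Ω (l.map (ε • ·))))) (𝓝[>] 0) (𝓝 0) := by
  induction l with
  | nil => simp [endpoint, diffQuot_zero]
  | cons v l ih =>
    have hshift : Tendsto (fun ε : ℝ => eLpNorm (fun p =>
        inner ℝ (G (mul p (hexp (ε • v)))) (endpoint l).1 - inner ℝ (G p) (endpoint l).1) s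
        (volume.restrict (segmentDomain Ω (ε • v)))) (𝓝[>] 0) (𝓝 0) := by
      refine ENNReal.tendsto_nhds_zero.2 fun η hη => ?_
      filter_upwards [(eventually_forall_eLpNorm_comp_mul_hexp_sub_le hs hs' hΩ
        (hGs.inner_const (𝕜 := ℝ) (endpoint l).1) v hη).filter_mono nhdsWithin_le_nhds] with ε hε
      simpa only [one_smul] using hε 1 (by simp)
    have hsum := (ih.add hshift).add
      (tendsto_eLpNorm_diffQuot_hexp_sub_inner hs hs' hΩ hu hG hGs v)
    simp only [add_zero] at hsum
    exact tendsto_of_tendsto_of_tendsto_of_le_of_le tendsto_const_nhds hsum (fun _ => zero_le)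
      fun ε => eLpNorm_diffQuot_endpoint_cons_sub_inner_le hs hu.aestronglyMeasurable hGs.1 v l ε

variable {A : Set (Heis n)} {l : List (Hor n)}

lemma eventually_subset_pathDomain_map_smul (hAΩ : A ⊆ Ω) (hA : 0 < ccSetDist A (frontier Ω))
    (l : List (Hor n)) : ∀ᶠ ε : ℝ in 𝓝[>] 0, A ⊆ pathDomain Ω (l.map (ε • ·)) := by
  have hlen : Tendsto (fun ε : ℝ => ENNReal.ofReal (ε * pathLength l)) (𝓝[>] 0) (𝓝 0) := by
    have hcont : Continuous fun ε : ℝ => ENNReal.ofReal (ε * pathLength l) :=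
      ENNReal.continuous_ofReal.comp (by fun_prop)
    simpa using (hcont.tendsto 0).mono_left nhdsWithin_le_nhds
  filter_upwards [hlen.eventually_lt_const hA, self_mem_nhdsWithin] with ε hε hε0
  exact subset_pathDomain_of_lt_ccSetDist hAΩ (by rwa [pathLength_map_smul (le_of_lt hε0)])

end DifferenceQuotients

end Heisenberg

end

theorem mainTheorem5_general (n : ℕ) (hn : 1 ≤ n) (s : ℝ≥0∞) (hs : 1 ≤ s)
    (Ω : Set (Heisenberg.Heis n)) (hΩ : IsOpen Ω) (f : Heisenberg.Heis n → ℝ)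
    (gradf : Heisenberg.Heis n → Heisenberg.Hor n)
    (hgradf : Heisenberg.IsWeakHorizontalGradient Ω f gradf)
    (hmem : MemLp gradf s (volume.restrict Ω))
    (A : Set (Heisenberg.Heis n)) (hAΩ : A ⊆ Ω) :
    (s ≠ ∞ → 0 < Heisenberg.ccSetDist A (frontier Ω) → ∀ w : Heisenberg.Heis n,
      MemLp (fun p => inner ℝ (gradf p) w.1) s (volume.restrict A) ∧
      Tendsto
        (fun ε : ℝ => eLpNorm
          (fun p => Heisenberg.diffQuot f w ε p - inner ℝ (gradf p) w.1) s (volume.restrict A))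
        (𝓝[>] 0) (𝓝 0)) ∧
    (∀ (w : Heisenberg.Heis n) (ε : ℝ), 0 < ε →
      ENNReal.ofReal (ε * (‖w.1‖ + 2 * √|w.2|)) < Heisenberg.ccSetDist A (frontier Ω) →
      (∀ p ∈ A, Heisenberg.mul p (Heisenberg.dil ε w) ∈ Ω) ∧
      MemLp (Heisenberg.diffQuot f w ε) s (volume.restrict A) ∧
      eLpNorm (Heisenberg.diffQuot f w ε) s (volume.restrict A) ≤
        ENNReal.ofReal (‖w.1‖ + 2 * √|w.2|) * eLpNorm gradf s (volume.restrict Ω)) := by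
  open Heisenberg in
  have hf : LocallyIntegrableOn f Ω volume := (hgradf (Sum.inl ⟨0, hn⟩)).1
  refine ⟨fun hs' hA w => ?_, fun w ε hε hw => ?_⟩
  · obtain ⟨l, rfl, -⟩ := exists_endpoint_eq hn w
    refine ⟨(hmem.mono_measure (Measure.restrict_mono hAΩ le_rfl)).inner_const _, ?_⟩
    refine tendsto_of_tendsto_of_tendsto_of_le_of_le' tendsto_const_nhds
      (tendsto_eLpNorm_diffQuot_endpoint_sub_inner hs hs' hΩ hf hgradf hmem l)
      (Eventually.of_forall fun _ => zero_le) ?_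
    filter_upwards [eventually_subset_pathDomain_map_smul hAΩ hA l] with ε hε
    exact eLpNorm_mono_measure _ (Measure.restrict_mono hε le_rfl)
  · obtain ⟨l, rfl, hl⟩ := exists_endpoint_eq hn w
    rw [← hl] at hw ⊢
    have hAl : A ⊆ pathDomain Ω (l.map (ε • ·)) :=
      subset_pathDomain_of_lt_ccSetDist hAΩ (by rwa [pathLength_map_smul hε.le])
    have hmaps := (mapsTo_mul_dil_endpoint ε l).mono_left hAl
    have hle := (eLpNorm_mono_measure _ (Measure.restrict_mono hAl le_rfl)).trans
      (eLpNorm_diffQuot_endpoint_le hs hΩ hf hgradf hε l)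
    exact ⟨hmaps, ⟨aestronglyMeasurable_diffQuot hf.aestronglyMeasurable hAΩ hmaps,
      hle.trans_lt (ENNReal.mul_lt_top ENNReal.ofReal_lt_top hmem.2)⟩, hle⟩

theorem mainTheorem5 (n : ℕ) (hn : 1 ≤ n) (s : ℝ≥0∞) (hs : 1 ≤ s) (hs' : s ≠ ∞)
    (Ω : Set (Heisenberg.Heis n)) (hΩ : IsOpen Ω)
    (f : Heisenberg.Heis n → ℝ) (hf : Heisenberg.MemHorizontalSobolev s Ω f)
    (gradf : Heisenberg.Heis n → Heisenberg.Hor n)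
    (hgradf : Heisenberg.IsWeakHorizontalGradient Ω f gradf)
    (A : Set (Heisenberg.Heis n)) (hA : IsOpen A) (hAΩ : A ⊆ Ω)
    (hdist : 0 < Heisenberg.ccSetDist A (frontier Ω)) :
    (∀ w : Heisenberg.Heis n,
      MemLp (fun p => inner ℝ (gradf p) w.1) s (volume.restrict A) ∧
      Tendsto
        (fun ε : ℝ => eLpNorm
          (fun p => Heisenberg.diffQuot f w ε p - inner ℝ (gradf p) w.1) s (volume.restrict A))
        (𝓝[>] 0) (𝓝 0)) ∧
    (∀ (w : Heisenberg.Heis n) (ε : ℝ), 0 < ε →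
      ENNReal.ofReal (ε * (‖w.1‖ + 2 * √|w.2|)) < Heisenberg.ccSetDist A (frontier Ω) →
      (∀ p ∈ A, Heisenberg.mul p (Heisenberg.dil ε w) ∈ Ω) ∧
      MemLp (Heisenberg.diffQuot f w ε) s (volume.restrict A) ∧
      eLpNorm (Heisenberg.diffQuot f w ε) s (volume.restrict A) ≤
        ENNReal.ofReal (‖w.1‖ + 2 * √|w.2|) * eLpNorm gradf s (volume.restrict Ω)) := by
  have h := mainTheorem5_general n hn s hs Ω hΩ f gradf hgradf (hf.memLp_gradient hΩ hgradf) A hAΩ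
  exact ⟨h.1 hs' hdist, h.2⟩
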